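/- Let $n\ge 3$, and label the vertices of a convex $n$-gon cyclically by $1,\dots,n$ (indices modulo $n$). Let $\mathcal E_n=\mathcal K_n=\mathbb R^{n(n-3)/2}$ with coordinates $x_{ij}$ (on $\mathcal E_n$) and $X_{ij}$ (on $\mathcal K_n$) indexed by the chords $(i,j)$ of the $n$-gon; put $x_{ii}=x_{i,i+1}=0$, $x_{ij}=x_{ji}$, and likewise for $X$. Let $$y_{ij}=x_{i,j+1}+x_{i+1,j}-x_{ij}-x_{i+1,j+1},\qquad s_{ij}=X_{i,j+1}+X_{i+1,j}-X_{ij}-X_{i+1,j+1},\qquad s_I=\sum_{\{i,j\}\subseteq I,\ i<j}s_{ij}.$$ For a triangulation $T$ of the $n$-gon let $T^c=\{(i,j) : (i+1,j+1)\in T\}$, and for constants $c_{ij}>0$ let $$A_n^{T}=\{x\in\mathcal E_n : x_{ij}\ge 0\text{ for all chords }(i,j),\ \ y_{ij}=-c_{ij}\text{ for all chords }(i,j)\notin T^c\}$$ be the ABHY associahedron. For $\sigma\in S_n$ let $f_\sigma:\mathcal E_n\to\mathcal K_n$ be the linear isomorphism sending the point $(x_{ij})$ to the point at which $s_{\sigma(i)\sigma(i+1)\cdots\sigma(j-1)}=x_{ij}$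 for all chords $(i,j)$, $i<j$, and let $A_n^{T,\sigma}=f_\sigma(A_n^T)$. For an orientation of the $(n-3)$-dimensional simple polytope $A_n^{T}$, respectively $A_n^{T,\sigma}$, its canonical form is the $(n-3)$-form on $\mathcal E_n$, respectively $\mathcal K_n$, $$\Omega(A_n^T)=\sum_{v}\pm\bigwedge_{(i,j)}d\log x_{ij},\qquad \Omega(A_n^{T,\sigma})=\sum_{v}\pm\bigwedge_{(i,j)}d\log s_{\sigma(i)\cdots\sigma(j-1)},$$ where $v$ runs over the vertices of the polytope, the wedge product is over the $n-3$ facets through $v$ (a facet being the locus where $x_{ij}$, respectively $s_{\sigma(i)\cdots\sigma(j-1)}$, vanishes for one chord $(i,j)$), taken in any order, and the sign is $+$ if the wedge product of the differentials $dx_{ij}$, respectively $ds_{\sigma(i)\cdots\sigma(j-1)}$, of these functions in that order is positive on the oriented polytope, and $-$ if it is negative. Then orientations of the polytopes $A_n^{T}$ (for all $T$ and all positive constants) can be chosen such that (a) $\Omega(A_n^{T})$ is the same form on $\mathcal E_n$ (away from its poles $x_{ij}=0$) for all $T$ and all choices of the positive constants; and, for every $\sigma\in S_n$, when $A_n^{T,\sigma}$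 carries the orientation transported by $f_\sigma$: (b) $\Omega(A_n^{T,\sigma})=(f_\sigma^{-1})^*\,\Omega(A_n^{T})$ for every $T$ and all positive constants; (c) $\Omega(A_n^{T_1,\sigma})=\Omega(A_n^{T_2,\sigma})$ for all triangulations $T_1,T_2$ of the $n$-gon and any positive constants used in the two realisations (both as forms on the complement of the hyperplanes $s_{\sigma(i)\cdots\sigma(j-1)}=0$ in $\mathcal K_n$). -/

import Mathlib

open Set

noncomputable section

namespace ABHY

/-! ### Chords and triangulations of the `n`-gon

The vertices of the polygon are `0, …, n - 1` in cyclic order, that is, the elements of `Fin n`,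
on which addition is modulo `n`. -/

/-- Chords (diagonals) of the `n`-gon: pairs `fst < snd` of distinct, non-adjacent vertices. -/
structure Chord (n : ℕ) where
  fst : Fin n
  snd : Fin n
  isChord : fst.val + 1 < snd.val ∧ ¬(fst.val = 0 ∧ snd.val + 1 = n)

theorem Chord.pair_injective {n : ℕ} :
    Function.Injective (fun a : Chord n => (a.fst, a.snd)) := by
  rintro ⟨i, j, h⟩ ⟨i', j', h'⟩ e
  simp only [Prod.mk.injEq] at e
  obtain ⟨rfl, rfl⟩ := e
  rfl

instance (n : ℕ) : Fintype (Chord n) :=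
  @Fintype.ofFinite _ (Finite.of_injective _ Chord.pair_injective)

instance (n : ℕ) : DecidableEq (Chord n) := Classical.decEq _

/-- Two chords cross if they meet in the interior of the polygon. -/
def Chord.Crosses {n : ℕ} (a b : Chord n) : Prop :=
  (a.fst < b.fst ∧ b.fst < a.snd ∧ a.snd < b.snd) ∨
    (b.fst < a.fst ∧ a.fst < b.snd ∧ b.snd < a.snd)

/-- A triangulation of the `n`-gon: a maximal set of pairwise non-crossing chords. -/
structure Triangulation (n : ℕ) where
  chords : Finset (Chord n)
  noncrossing : ∀ a ∈ chords, ∀ b ∈ chords, ¬ a.Crosses b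
  maximal : ∀ a, (∀ b ∈ chords, ¬ a.Crosses b) → a ∈ chords

/-- The unordered pair `{i, j}` is a chord of the triangulation `T`. -/
def Triangulation.Mem {n : ℕ} (T : Triangulation n) (i j : Fin n) : Prop :=
  ∃ a ∈ T.chords, (a.fst = i ∧ a.snd = j) ∨ (a.fst = j ∧ a.snd = i)

/-- `a ∈ T^c`, where `T^c` is `T` rotated by one step: `(i, j) ∈ T^c` iff `(i + 1, j + 1) ∈ T`
(indices modulo `n`). For instance the rotation of `{(1,3), …, (1,n-1)}` (in the labels
`1, …, n`) is `{(2,n), …, (n-2,n)}`. -/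
def Triangulation.MemRot {n : ℕ} [NeZero n] (T : Triangulation n) (a : Chord n) : Prop :=
  T.Mem (a.fst + 1) (a.snd + 1)

/-! ### Embedding space, kinematic space, Mandelstam variables -/

/-- The embedding space `ℝ^{n(n-3)/2}`, with coordinates `x_{ij}` labelled by the chords. -/
abbrev EmbeddingSpace (n : ℕ) : Type := Chord n → ℝ

/-- The kinematic space `ℝ^{n(n-3)/2}` of `n` massless particles, with coordinates the planar
variables `X_{ij} = (p_i + … + p_{j-1})²` labelled by the chords. -/
abbrev KinematicSpace (n : ℕ) : Type := Chord n → ℝ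

/-- `x_{ij}` for an arbitrary pair of vertices: symmetric in `i, j`, and zero if `i = j` or
`i, j` are adjacent. -/
def planar {n : ℕ} (x : Chord n → ℝ) (i j : Fin n) : ℝ :=
  if h : i.val + 1 < j.val ∧ ¬(i.val = 0 ∧ j.val + 1 = n) then x ⟨i, j, h⟩
  else if h : j.val + 1 < i.val ∧ ¬(j.val = 0 ∧ i.val + 1 = n) then x ⟨j, i, h⟩
  else 0

/-- The two-particle Mandelstam variables as functions of the planar variables:
`s_{ij} = X_{i,j+1} + X_{i+1,j} - X_{ij} - X_{i+1,j+1}`. On the embedding space these are the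
functions `y_{ij}`. -/
def mandelstam {n : ℕ} [NeZero n] (x : Chord n → ℝ) (i j : Fin n) : ℝ :=
  planar x i (j + 1) + planar x (i + 1) j - planar x i j - planar x (i + 1) (j + 1)

/-- The multi-particle Mandelstam variable `s_I = ∑_{i < j in I} s_{ij}`. -/
def mandelstamSet {n : ℕ} [NeZero n] (x : Chord n → ℝ) (I : Finset (Fin n)) : ℝ :=
  ∑ p ∈ (I ×ˢ I).filter (fun p => p.1 < p.2), mandelstam x p.1 p.2

/-- The set `{σ(i), σ(i+1), …, σ(j-1)}` attached to the chord `(i, j)`. -/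
def Chord.label {n : ℕ} (σ : Equiv.Perm (Fin n)) (a : Chord n) : Finset (Fin n) :=
  (Finset.Ico a.fst a.snd).map σ.toEmbedding

theorem planar_add {n : ℕ} (x y : Chord n → ℝ) (i j : Fin n) :
    planar (x + y) i j = planar x i j + planar y i j := by
  unfold planar; split_ifs <;> simp

theorem planar_smul {n : ℕ} (r : ℝ) (x : Chord n → ℝ) (i j : Fin n) :
    planar (r • x) i j = r * planar x i j := by
  unfold planar; split_ifs <;> simp

theorem planar_comm {n : ℕ} (x : Chord n → ℝ) (i j : Fin n) :
    planar x i j = planar x j i := by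
  unfold planar; split_ifs <;> first | rfl | omega

theorem planar_self {n : ℕ} (x : Chord n → ℝ) (i : Fin n) : planar x i i = 0 := by
  unfold planar; split_ifs <;> first | rfl | omega

theorem planar_chord {n : ℕ} (x : Chord n → ℝ) (a : Chord n) :
    planar x a.fst a.snd = x a := by
  unfold planar; rw [dif_pos a.isChord]

theorem val_add_one {n : ℕ} [NeZero n] (i : Fin n) :
    (i + 1).val = if i.val + 1 = n then 0 else i.val + 1 := by
  rcases n with _ | n
  · exact i.elim0
  · rw [Fin.val_add_one]
    simp only [Fin.ext_iff, Fin.val_last, Nat.add_right_cancel_iff]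

theorem planar_succ {n : ℕ} [NeZero n] (x : Chord n → ℝ) (i : Fin n) :
    planar x i (i + 1) = 0 := by
  have h := val_add_one i
  unfold planar; split_ifs at h ⊢ <;> first | rfl | omega

theorem mandelstam_comm {n : ℕ} [NeZero n] (x : Chord n → ℝ) (i j : Fin n) :
    mandelstam x i j = mandelstam x j i := by
  unfold mandelstam
  rw [planar_comm x i (j + 1), planar_comm x (i + 1) j, planar_comm x i j,
    planar_comm x (i + 1) (j + 1)]
  ring

theorem mandelstam_self {n : ℕ} [NeZero n] (x : Chord n → ℝ) (i : Fin n) :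
    mandelstam x i i = 0 := by
  unfold mandelstam
  rw [planar_comm x (i + 1) i, planar_succ, planar_self, planar_self]; ring

/-- Momentum conservation. -/
theorem sum_mandelstam {n : ℕ} [NeZero n] (x : Chord n → ℝ) (i : Fin n) :
    ∑ j, mandelstam x i j = 0 := by
  have h : ∀ k : Fin n, ∑ j, planar x k (j + 1) = ∑ j, planar x k j := fun k =>
    Equiv.sum_comp (Equiv.addRight (1 : Fin n)) (fun j => planar x k j)
  simp only [mandelstam, Finset.sum_add_distrib, Finset.sum_sub_distrib, h]
  ring

theorem mandelstam_add {n : ℕ} [NeZero n] (x y : Chord n → ℝ) (i j : Fin n) :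
    mandelstam (x + y) i j = mandelstam x i j + mandelstam y i j := by
  simp only [mandelstam, planar_add]; ring

theorem mandelstam_smul {n : ℕ} [NeZero n] (r : ℝ) (x : Chord n → ℝ) (i j : Fin n) :
    mandelstam (r • x) i j = r * mandelstam x i j := by
  simp only [mandelstam, planar_smul]; ring

theorem two_mul_sum_lt {n : ℕ} (t : Fin n → Fin n → ℝ) (hc : ∀ i j, t i j = t j i)
    (h0 : ∀ i, t i i = 0) (I : Finset (Fin n)) :
    2 * ∑ p ∈ (I ×ˢ I).filter (fun p => p.1 < p.2), t p.1 p.2 = ∑ i ∈ I, ∑ j ∈ I, t i j := by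
  have h1 : ∑ p ∈ (I ×ˢ I).filter (fun p => p.1 < p.2), t p.1 p.2
      = ∑ i ∈ I, ∑ j ∈ I, if i < j then t i j else 0 := by
    rw [Finset.sum_filter, Finset.sum_product]
  have h2 : ∑ i ∈ I, ∑ j ∈ I, (if i < j then t i j else 0)
      = ∑ i ∈ I, ∑ j ∈ I, if j < i then t i j else 0 := by
    rw [Finset.sum_comm]
    refine Finset.sum_congr rfl fun i _ => Finset.sum_congr rfl fun j _ => ?_
    rw [hc]
  rw [h1, two_mul]
  nth_rewrite 2 [h2]
  simp only [← Finset.sum_add_distrib]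
  refine Finset.sum_congr rfl fun i _ => Finset.sum_congr rfl fun j _ => ?_
  rcases lt_trichotomy i j with h | h | h
  · simp [h, h.not_gt]
  · subst h; simp [h0]
  · simp [h, h.not_gt]

theorem two_mul_mandelstamSet {n : ℕ} [NeZero n] (x : Chord n → ℝ) (I : Finset (Fin n)) :
    2 * mandelstamSet x I = ∑ i ∈ I, ∑ j ∈ I, mandelstam x i j :=
  two_mul_sum_lt _ (mandelstam_comm x) (mandelstam_self x) I

/-- The linear map `x ↦ (s_{σ(i) … σ(j-1)}(x))_{(i,j)}`. -/
def permMap {n : ℕ} [NeZero n] (σ : Equiv.Perm (Fin n)) :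
    (Chord n → ℝ) →ₗ[ℝ] (Chord n → ℝ) where
  toFun x a := mandelstamSet x (a.label σ)
  map_add' x y := by
    funext a; simp [mandelstamSet, mandelstam_add, Finset.sum_add_distrib]
  map_smul' r x := by
    funext a; simp [mandelstamSet, mandelstam_smul, Finset.mul_sum]

theorem two_mul_permMap {n : ℕ} [NeZero n] (σ : Equiv.Perm (Fin n)) (x : Chord n → ℝ)
    (a : Chord n) : 2 * permMap σ x a =
      ∑ i ∈ Finset.Ico a.fst a.snd, ∑ j ∈ Finset.Ico a.fst a.snd,
        mandelstam x (σ i) (σ j) := by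
  change 2 * mandelstamSet x (a.label σ) = _
  rw [two_mul_mandelstamSet]
  simp [Chord.label]

/-- `x_{ij} = y_{i, i+1, …, j-1}`. -/
theorem permMap_one {n : ℕ} [NeZero n] (x : Chord n → ℝ) : permMap 1 x = x := by
  funext a
  have key := two_mul_permMap 1 x a
  have conv : ∀ f : Fin n → ℝ, ∑ i ∈ Finset.Ico a.fst a.snd, f i
      = ∑ m ∈ Finset.Ico a.fst.val a.snd.val, f (Fin.ofNat n m) := by
    intro f
    rw [← Fin.map_valEmbedding_Ico, Finset.sum_map]
    simp
  have hle : a.fst.val ≤ a.snd.val := by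
    have := a.isChord.1
    omega
  have hs : ∀ m : ℕ, Fin.ofNat n (m + 1) = Fin.ofNat n m + 1 := by
    intro m; apply Fin.ext; simp [Fin.val_add]
  have tele : ∀ g : Fin n → ℝ, ∑ i ∈ Finset.Ico a.fst a.snd, (g (i + 1) - g i)
      = g a.snd - g a.fst := by
    intro g
    rw [conv]
    have := Finset.sum_Ico_sub (fun m => g (Fin.ofNat n m)) hle
    simp only [hs] at this
    rw [this]; simp
  have h1 : ∀ i : Fin n, ∑ j ∈ Finset.Ico a.fst a.snd, mandelstam x i j
      = (planar x i a.snd - planar x i a.fst)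
        - (planar x (i + 1) a.snd - planar x (i + 1) a.fst) := by
    intro i
    rw [← tele (fun j => planar x i j), ← tele (fun j => planar x (i + 1) j),
      ← Finset.sum_sub_distrib]
    refine Finset.sum_congr rfl fun j _ => ?_
    unfold mandelstam; ring
  simp only [Equiv.Perm.one_apply, h1] at key
  have h2 := tele (fun i => planar x i a.fst - planar x i a.snd)
  have h3 : ∑ i ∈ Finset.Ico a.fst a.snd, ((planar x i a.snd - planar x i a.fst)
        - (planar x (i + 1) a.snd - planar x (i + 1) a.fst))
      = ∑ i ∈ Finset.Ico a.fst a.snd, ((planar x (i + 1) a.fst - planar x (i + 1) a.snd)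
        - (planar x i a.fst - planar x i a.snd)) :=
    Finset.sum_congr rfl fun i _ => by ring
  rw [h3, h2, planar_self, planar_self, planar_comm x a.snd a.fst, planar_chord] at key
  linarith

/-- `s_{ij}` at the image point is `s_{σ(i)σ(j)}` at the original point. -/
theorem mandelstam_permMap {n : ℕ} [NeZero n] (σ : Equiv.Perm (Fin n)) (x : Chord n → ℝ)
    (i j : Fin n) : mandelstam (permMap σ x) i j = mandelstam x (σ i) (σ j) := by
  set t : Fin n → Fin n → ℝ := fun i j => mandelstam x (σ i) (σ j) with ht
  have tc : ∀ i j, t i j = t j i := fun i j => mandelstam_comm x _ _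
  have t0 : ∀ i, t i i = 0 := fun i => mandelstam_self x _
  have tr : ∀ i, ∑ j, t i j = 0 := fun i => by
    rw [ht]
    exact (Equiv.sum_comp σ (fun j => mandelstam x (σ i) j)).trans (sum_mandelstam x (σ i))
  -- initial segments and their double sums
  set J : ℕ → Finset (Fin n) := fun m => Finset.univ.filter (fun k => k.val < m) with hJ
  set C : ℕ → ℕ → ℝ := fun a b => ∑ k ∈ J a, ∑ l ∈ J b, t k l with hC
  have Cc : ∀ a b, C a b = C b a := fun a b => by
    simp only [hC]; rw [Finset.sum_comm]; simp only [tc]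
  have J0 : J 0 = ∅ := by simp [hJ]
  have Jn : J n = Finset.univ := by simp [hJ]
  have C0 : ∀ a, C 0 a = 0 := fun a => by simp [hC, J0]
  have Cn' : ∀ a, C a n = 0 := fun a => by simp [hC, Jn, tr]
  have Cn : ∀ a, C n a = 0 := fun a => by rw [Cc, Cn']
  have JS : ∀ k : Fin n, J (k.val + 1) = insert k (J k.val) := by
    intro k; ext l; simp [hJ, Fin.ext_iff]; omega
  have JN : ∀ k : Fin n, k ∉ J k.val := by intro k; simp [hJ]
  have CS : ∀ (k : Fin n) (b : ℕ), C (k.val + 1) b = (∑ l ∈ J b, t k l) + C k.val b := by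
    intro k b; simp only [hC]; rw [JS, Finset.sum_insert (JN k)]
  have RS : ∀ (k l : Fin n), ∑ m ∈ J (l.val + 1), t k m = t k l + ∑ m ∈ J l.val, t k m := by
    intro k l; rw [JS, Finset.sum_insert (JN l)]
  have Csucc : ∀ (k : Fin n) (b : ℕ), C (k + 1 : Fin n).val b = C (k.val + 1) b := by
    intro k b
    rw [val_add_one]
    split_ifs with h
    · rw [h, C0, Cn]
    · rfl
  have Csucc' : ∀ (k : Fin n) (b : ℕ), C b (k + 1 : Fin n).val = C b (k.val + 1) := by
    intro k b; rw [Cc, Csucc, Cc]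
  have hperm : ∀ a : Chord n, 2 * permMap σ x a
      = C a.fst.val a.fst.val + C a.snd.val a.snd.val - 2 * C a.fst.val a.snd.val := by
    intro a
    rw [two_mul_permMap]
    have hlt : a.fst.val ≤ a.snd.val := by
      have := a.isChord.1
      omega
    have hd : Disjoint (J a.fst.val) (Finset.Ico a.fst a.snd) := by
      rw [Finset.disjoint_left]; intro l; simp only [hJ, Finset.mem_filter, Finset.mem_univ,
        true_and, Finset.mem_Ico, Fin.le_def]; omega
    have hu : J a.snd.val = (J a.fst.val).disjUnion (Finset.Ico a.fst a.snd) hd := by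
      ext l
      simp only [hJ, Finset.mem_filter, Finset.mem_univ, true_and, Finset.mem_disjUnion,
        Finset.mem_Ico, Fin.le_def, Fin.lt_def]
      omega
    have e1 : C a.snd.val a.snd.val = C a.fst.val a.snd.val
        + ∑ k ∈ Finset.Ico a.fst a.snd, ∑ l ∈ J a.snd.val, t k l := by
      simp only [hC]; conv_lhs => rw [hu]
      rw [Finset.sum_disjUnion, ← hu]
    have e2 : ∑ k ∈ Finset.Ico a.fst a.snd, ∑ l ∈ J a.snd.val, t k l
        = (∑ k ∈ Finset.Ico a.fst a.snd, ∑ l ∈ J a.fst.val, t k l)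
          + ∑ k ∈ Finset.Ico a.fst a.snd, ∑ l ∈ Finset.Ico a.fst a.snd, t k l := by
      rw [← Finset.sum_add_distrib]
      refine Finset.sum_congr rfl fun k _ => ?_
      rw [hu, Finset.sum_disjUnion]
    have e3 : C a.snd.val a.fst.val = C a.fst.val a.fst.val
        + ∑ k ∈ Finset.Ico a.fst a.snd, ∑ l ∈ J a.fst.val, t k l := by
      simp only [hC]; rw [hu, Finset.sum_disjUnion]
    have e4 := Cc a.snd.val a.fst.val
    change ∑ k ∈ Finset.Ico a.fst a.snd, ∑ l ∈ Finset.Ico a.fst a.snd, t k l = _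
    linarith
  have Cself : ∀ k : Fin n, C k.val k.val + C (k.val + 1) (k.val + 1)
      - 2 * C k.val (k.val + 1) = 0 := by
    intro k
    have a1 := CS k (k.val + 1)
    have a2 := CS k k.val
    have a3 := RS k k
    have a4 := Cc k.val (k.val + 1)
    have a5 := t0 k
    linarith
  have hpl : ∀ k l : Fin n, 2 * planar (permMap σ x) k l
      = C k.val k.val + C l.val l.val - 2 * C k.val l.val := by
    have main : ∀ k l : Fin n, k.val ≤ l.val → 2 * planar (permMap σ x) k l
        = C k.val k.val + C l.val l.val - 2 * C k.val l.val := by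
      intro k l hkl
      by_cases h : k.val + 1 < l.val ∧ ¬(k.val = 0 ∧ l.val + 1 = n)
      · exact (congrArg (2 * ·) (planar_chord (permMap σ x) ⟨k, l, h⟩)).trans
          (hperm ⟨k, l, h⟩)
      · have hz : planar (permMap σ x) k l = 0 := by
          unfold planar; rw [dif_neg h, dif_neg (by omega)]
        rw [hz]
        have cases : k.val = l.val ∨ l.val = k.val + 1 ∨ (k.val = 0 ∧ l.val + 1 = n) := by
          omega
        rcases cases with h | h | ⟨h, h'⟩
        · rw [h]; ring
        · have := Cself k
          rw [h]; linarith
        · have := Cself l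
          rw [h', Cn, Cn'] at this
          rw [h, C0, C0]; linarith
    intro k l
    rcases le_total k.val l.val with h | h
    · exact main k l h
    · rw [planar_comm, main l k h, Cc l.val k.val]; ring
  have p1 := hpl i (j + 1)
  have p2 := hpl (i + 1) j
  have p3 := hpl i j
  have p4 := hpl (i + 1) (j + 1)
  simp only [Csucc, Csucc'] at p1 p2 p3 p4
  have q1 := CS i (j.val + 1)
  have q2 := CS i j.val
  have q3 := RS i j
  change mandelstam (permMap σ x) i j = t i j
  unfold mandelstam
  linarith

theorem permMap_permMap {n : ℕ} [NeZero n] (σ τ : Equiv.Perm (Fin n)) (x : Chord n → ℝ) :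
    permMap σ (permMap τ x) = permMap (τ * σ) x := by
  funext a
  have h1 := two_mul_permMap σ (permMap τ x) a
  have h2 := two_mul_permMap (τ * σ) x a
  simp only [mandelstam_permMap] at h1
  simp only [Equiv.Perm.mul_apply] at h2
  linarith

/-- The linear isomorphism `f_σ : x_{ij} ↦ s_{σ(i)σ(i+1)…σ(j-1)}` from the embedding space to the
kinematic space: it sends the point with coordinates `x_{ij}` to the point at which
`s_{σ(i)…σ(j-1)} = x_{ij}` for all chords `(i, j)`. Thus its inverse is
`X ↦ (s_{σ(i)…σ(j-1)}(X))`. -/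
def fMap {n : ℕ} [NeZero n] (σ : Equiv.Perm (Fin n)) : EmbeddingSpace n ≃ₗ[ℝ] KinematicSpace n :=
  LinearEquiv.symm
    { permMap σ with
      invFun := permMap σ⁻¹
      left_inv := fun x => by
        change permMap σ⁻¹ (permMap σ x) = x
        rw [permMap_permMap, mul_inv_cancel, permMap_one]
      right_inv := fun x => by
        change permMap σ (permMap σ⁻¹ x) = x
        rw [permMap_permMap, inv_mul_cancel, permMap_one] }

theorem fMap_symm_apply {n : ℕ} [NeZero n] (σ : Equiv.Perm (Fin n)) (X : KinematicSpace n)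
    (a : Chord n) : (fMap σ).symm X a = mandelstamSet X (a.label σ) := rfl

/-! ### The ABHY associahedra and their deformed realisations -/

/-- Positive constants `c_{ij}`. (Those with `(i, j) ∈ T^c` are not used.) -/
structure PosConst (n : ℕ) where
  val : Chord n → ℝ
  pos : ∀ a, 0 < val a

/-- The ABHY associahedron `A_n^T`: the points of the positive orthant of the embedding space with
`y_{ij} = -c_{ij}` for all chords `(i, j) ∉ T^c`. -/
def associahedron {n : ℕ} [NeZero n] (T : Triangulation n) (c : PosConst n) :
    Set (EmbeddingSpace n) :=
  {x | (∀ a, 0 ≤ x a) ∧ ∀ a, ¬ T.MemRot a → mandelstam x a.fst a.snd = -c.val a}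

/-- The deformed realisation `A_n^{T,σ}`, the image of `A_n^T` under `f_σ`. -/
def deformedAssociahedron {n : ℕ} [NeZero n] (T : Triangulation n) (c : PosConst n)
    (σ : Equiv.Perm (Fin n)) : Set (KinematicSpace n) :=
  fMap σ '' associahedron T c

/-- `A_n^{T,σ}` is the intersection of the `σ`-positive region `s_{σ(i)…σ(j-1)} ≥ 0` with the
hyperplanes `s_{σ(i)σ(j)} = -c_{ij}`, `(i, j) ∉ T^c`. -/
theorem mem_deformedAssociahedron {n : ℕ} [NeZero n] (T : Triangulation n) (c : PosConst n)
    (σ : Equiv.Perm (Fin n)) (X : KinematicSpace n) :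
    X ∈ deformedAssociahedron T c σ ↔ (∀ a : Chord n, 0 ≤ mandelstamSet X (a.label σ)) ∧
      ∀ a : Chord n, ¬ T.MemRot a → mandelstam X (σ a.fst) (σ a.snd) = -c.val a := by
  have h : ∀ i j, mandelstam ((fMap σ).symm X) i j = mandelstam X (σ i) (σ j) :=
    mandelstam_permMap σ X
  unfold deformedAssociahedron
  rw [LinearEquiv.image_eq_preimage_symm]
  simp only [mem_preimage, associahedron, mem_ofPred_eq, h, fMap_symm_apply]

/-! ### Canonical forms of oriented simple polytopes -/

section Forms

variable {V W ι : Type*} [AddCommGroup V] [Module ℝ V] [AddCommGroup W] [Module ℝ W] {k : ℕ}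

/-- A (not necessarily regular) differential `k`-form on `V`. -/
abbrev Form (V : Type*) [AddCommGroup V] [Module ℝ V] (k : ℕ) : Type _ :=
  V → V [⋀^Fin k]→ₗ[ℝ] ℝ

/-- Pull-back of a form along a linear map. -/
def Form.pullback (g : W →ₗ[ℝ] V) (ω : Form V k) : Form W k :=
  fun w => (ω (g w)).compLinearMap g

/-- The wedge product `α 0 ∧ ⋯ ∧ α (k - 1)` of covectors: its value at `(v_i)` is
`det (α j (v_i))`. -/
def wedge (α : Fin k → Module.Dual ℝ V) : V [⋀^Fin k]→ₗ[ℝ] ℝ :=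
  Matrix.detRowAlternating.compLinearMap (LinearMap.pi α)

/-- The differential `d log ℓ` of a linear function, at a point `x` with `ℓ x ≠ 0`. -/
def dlog (ℓ : Module.Dual ℝ V) (x : V) : Module.Dual ℝ V := (ℓ x)⁻¹ • ℓ

open Classical in
/-- The sign (`1`, `-1`, or `0` if `ω = 0`) of a top form with respect to an orientation of a
`k`-dimensional space. -/
def orientationSign (o : Orientation ℝ V (Fin k)) (ω : V [⋀^Fin k]→ₗ[ℝ] ℝ) : ℝ :=
  if ∃ h : ω ≠ 0, rayOfNeZero ℝ ω h = o then 1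
  else if ∃ h : ω ≠ 0, rayOfNeZero ℝ ω h = -o then -1
  else 0

/-- `S` is the set of facets through some vertex of the polytope `P` whose facets lie on the
hyperplanes `ℓ a = 0`. -/
def IsVertex (ℓ : ι → Module.Dual ℝ V) (P : Set V) (S : Finset ι) : Prop :=
  ∃ v ∈ P.extremePoints ℝ, ∀ a, a ∈ S ↔ ℓ a v = 0

open Classical in
/-- The canonical form of an oriented `k`-dimensional simple polytope `P ⊆ V` (not necessarily of
full dimension) which is cut out of its affine span by the inequalities `ℓ a ≥ 0`, each of which
defines a facet:
`∑_v ± ⋀_{a facet through v} d log ℓ_a`, a `d log` form on `V`. The sum is over the vertices of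
`P` (a vertex being given by the set `S` of the `k` facets through it), and the sign is the one by
which the restriction of `⋀_{a ∈ S} dℓ_a` to `P` orients `P`. The enumeration `e` of `S` is
immaterial, as it enters twice. -/
def canonicalForm [Fintype ι] (ℓ : ι → Module.Dual ℝ V) (P : Set V)
    (o : Orientation ℝ (vectorSpan ℝ P) (Fin k)) : Form V k := fun x =>
  ∑ S : Finset ι,
    if h : IsVertex ℓ P S ∧ S.card = k then
      let e : Fin k ≃ S := (S.equivFinOfCardEq h.2).symm
      orientationSign o (wedge fun i => (ℓ (e i)).domRestrict (vectorSpan ℝ P)) •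
        wedge fun i => dlog (ℓ (e i)) x
    else 0

/-- A linear isomorphism transports orientations of `P` to orientations of its image. -/
def mapOrientation (f : V ≃ₗ[ℝ] W) (P : Set V) (o : Orientation ℝ (vectorSpan ℝ P) (Fin k)) :
    Orientation ℝ (vectorSpan ℝ (f '' P)) (Fin k) :=
  Orientation.map (Fin k) ((f.submoduleMap (vectorSpan ℝ P)).trans
    (LinearEquiv.ofEq _ _
      (AffineMap.map_vectorSpan (f : V →ₗ[ℝ] W).toAffineMap (s := P)))) o

end Forms

/-- The coordinate functions `x_{ij}` on the embedding space. -/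
def coord {n : ℕ} (a : Chord n) : Module.Dual ℝ (EmbeddingSpace n) := LinearMap.proj a

/-- The functions `s_{σ(i)…σ(j-1)} = x_{ij} ∘ f_σ⁻¹` on the kinematic space. -/
def sigmaCoord {n : ℕ} [NeZero n] (σ : Equiv.Perm (Fin n)) (a : Chord n) :
    Module.Dual ℝ (KinematicSpace n) :=
  coord a ∘ₗ (fMap σ).symm.toLinearMap

/-- The canonical form `Ω(A_n^T)` on the embedding space, for a given orientation of `A_n^T`. -/
def Omega {n : ℕ} [NeZero n] (T : Triangulation n) (c : PosConst n)
    (o : Orientation ℝ (vectorSpan ℝ (associahedron T c)) (Fin (n - 3))) :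
    Form (EmbeddingSpace n) (n - 3) :=
  canonicalForm coord (associahedron T c) o

/-- The canonical form `Ω(A_n^{T,σ})` on the kinematic space, for a given orientation of
`A_n^{T,σ}`. -/
def OmegaDeformed {n : ℕ} [NeZero n] (T : Triangulation n) (c : PosConst n)
    (σ : Equiv.Perm (Fin n))
    (o : Orientation ℝ (vectorSpan ℝ (deformedAssociahedron T c σ)) (Fin (n - 3))) :
    Form (KinematicSpace n) (n - 3) :=
  canonicalForm (sigmaCoord σ) (deformedAssociahedron T c σ) o

/-- The complement of the poles `x_{ij} = 0` in the embedding space. -/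
def regular (n : ℕ) : Set (EmbeddingSpace n) := {x | ∀ a, x a ≠ 0}

/-- The complement of the poles `s_{σ(i)…σ(j-1)} = 0` in the kinematic space. -/
def regularDeformed {n : ℕ} [NeZero n] (σ : Equiv.Perm (Fin n)) : Set (KinematicSpace n) :=
  {X | ∀ a : Chord n, mandelstamSet X (a.label σ) ≠ 0}

end ABHY

end

open Set
namespace ABHY

/-! ### Chords and triangulations in terms of natural numbers -/

/-! The canonical form is determined by the facet sets of the vertices and their signs; both turn
out to be independent of `T` and of the constants.

The engine is `exchange`. For `i < j < k < l`, summing the `y`'s over the rectangle `[i,j) × [k,l)`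
or over `[j,k) × [l,i+n)` expresses `x_ik + x_jl` through two opposite sides of the quadrilateral.
An unconstrained mesh in each rectangle would give two crossing chords of `T`, so one rectangle is
fully constrained. On the polytope this makes `x_ik + x_jl` strictly larger than a sum of two
nonnegative sides, so facets of crossing chords are disjoint. On directions `w` of the affine span
it gives `w_ik + w_jl` equal to a sum of two sides.

Consequently the chords of any triangulation are coordinates on the affine span
(`eq_zero_of_zero_on`, `exists_coords`). Every triangulation is a vertex (`realizes`): the fan is
obtained by deforming an explicit point, and the others by walking along edges, since flips connect
all triangulations (`flip_induction`). A flip replaces `dx_a` by `dx_b = -dx_a +` sides, hence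
changes the sign of the wedge for every `T` (`exists_sign`). Orienting each polytope by the fan then
gives (a). Naturality under linear isomorphisms (`canonicalForm_image`) gives (b), and (c) follows
from both. -/

theorem Chord.ext_val {n : ℕ} {a b : Chord n} (h₁ : a.fst.val = b.fst.val)
    (h₂ : a.snd.val = b.snd.val) : a = b :=
  Chord.pair_injective (Prod.ext (Fin.ext h₁) (Fin.ext h₂))

theorem Chord.crosses_iff {n : ℕ} {a b : Chord n} : a.Crosses b ↔
    (a.fst.val < b.fst.val ∧ b.fst.val < a.snd.val ∧ a.snd.val < b.snd.val) ∨
      (b.fst.val < a.fst.val ∧ a.fst.val < b.snd.val ∧ b.snd.val < a.snd.val) := Iff.rfl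

theorem Chord.crosses_comm {n : ℕ} {a b : Chord n} : a.Crosses b ↔ b.Crosses a := by
  simp only [Chord.crosses_iff]; omega

theorem Triangulation.mem_comm {n : ℕ} {T : Triangulation n} {i j : Fin n} :
    T.Mem i j ↔ T.Mem j i := by
  unfold Triangulation.Mem
  exact exists_congr fun a => and_congr_right fun _ => or_comm

/-- The constraint hyperplanes' directions: the vectors on which all the constrained `y_{ij}`
vanish. -/
def meshKernel {n : ℕ} [NeZero n] (T : Triangulation n) : Submodule ℝ (EmbeddingSpace n) where
  carrier := {w | ∀ a, ¬ T.MemRot a → mandelstam w a.fst a.snd = 0}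
  add_mem' := fun hx hy a ha => by rw [mandelstam_add, hx a ha, hy a ha, add_zero]
  zero_mem' := fun a _ => by
    have := mandelstam_smul 0 (0 : Chord n → ℝ) a.fst a.snd
    simpa using this
  smul_mem' := fun r x hx a ha => by rw [mandelstam_smul, hx a ha, mul_zero]

/-! ### Rectangle sums of Mandelstam variables -/

theorem ofNat_succ {n : ℕ} [NeZero n] (m : ℕ) : Fin.ofNat n (m + 1) = Fin.ofNat n m + 1 := by
  apply Fin.ext; simp [Fin.val_add]

/-- `mandelstam` is minus a mixed second difference, so the double sum telescopes to the corners.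
Natural-number indices, reduced modulo `n`, let a rectangle wrap past the last vertex. -/
theorem sum_rectangle {n : ℕ} [NeZero n] (x : Chord n → ℝ) {i j k l : ℕ} (hij : i ≤ j)
    (hkl : k ≤ l) :
    ∑ p ∈ Finset.Ico i j, ∑ q ∈ Finset.Ico k l, mandelstam x (Fin.ofNat n p) (Fin.ofNat n q) =
      planar x (Fin.ofNat n i) (Fin.ofNat n l) + planar x (Fin.ofNat n j) (Fin.ofNat n k)
        - planar x (Fin.ofNat n i) (Fin.ofNat n k) - planar x (Fin.ofNat n j) (Fin.ofNat n l) := by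
  set X : ℕ → ℕ → ℝ := fun p q => planar x (Fin.ofNat n p) (Fin.ofNat n q) with hX
  have h1 : ∀ p, ∑ q ∈ Finset.Ico k l, mandelstam x (Fin.ofNat n p) (Fin.ofNat n q)
      = (X (p + 1) k - X (p + 1) l) - (X p k - X p l) := by
    intro p
    have a := Finset.sum_Ico_sub (fun q => X p q) hkl
    have b := Finset.sum_Ico_sub (fun q => X (p + 1) q) hkl
    have : ∀ q, mandelstam x (Fin.ofNat n p) (Fin.ofNat n q)
        = (X p (q + 1) - X p q) - (X (p + 1) (q + 1) - X (p + 1) q) := by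
      intro q; simp only [hX, mandelstam, ofNat_succ]; ring
    simp only [this, Finset.sum_sub_distrib] at a b ⊢
    linarith
  have c := Finset.sum_Ico_sub (fun p => X p k - X p l) hij
  simp only [h1, c]
  simp only [hX]; ring

/-- The mesh `(p, q)` is one of the constrained ones. -/
def IsConstrained {n : ℕ} [NeZero n] (T : Triangulation n) (p q : Fin n) : Prop :=
  ∃ a : Chord n, ¬ T.MemRot a ∧ ∀ x : Chord n → ℝ, mandelstam x p q = mandelstam x a.fst a.snd

/-! ### Constrained rectangles, exchange relations and disjoint facets -/

theorem isConstrained_or_mem {n : ℕ} [NeZero n] (T : Triangulation n) {p q : Fin n}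
    (h1 : p ≠ q) (h2 : p + 1 ≠ q) (h3 : q + 1 ≠ p) :
    IsConstrained T p q ∨ T.Mem (p + 1) (q + 1) := by
  have e1 := val_add_one p
  have e2 := val_add_one q
  have hp := p.isLt
  have hq := q.isLt
  rw [Ne, Fin.ext_iff] at h1 h2 h3
  by_cases hm : T.Mem (p + 1) (q + 1)
  · exact Or.inr hm
  left
  rcases lt_or_gt_of_ne h1 with h | h
  · refine ⟨⟨p, q, ?_⟩, hm, fun x => rfl⟩
    split_ifs at e1 e2 <;> omega
  · refine ⟨⟨q, p, ?_⟩, fun hm' => hm (Triangulation.mem_comm.1 hm'),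
      fun x => mandelstam_comm x _ _⟩
    split_ifs at e1 e2 <;> omega

theorem not_mem_cross {n : ℕ} (T : Triangulation n) {a b c d : Fin n}
    (h1 : T.Mem a c) (h2 : T.Mem b d) (hab : a < b) (hbc : b < c) (hd : d < a ∨ c < d) :
    False := by
  obtain ⟨s, hs, hs'⟩ := h1
  obtain ⟨t, ht, ht'⟩ := h2
  have := T.noncrossing s hs t ht
  have h3 := s.isChord.1
  have h4 := t.isChord.1
  rw [Chord.crosses_iff] at this
  simp only [Fin.lt_def, Fin.ext_iff] at *
  omega

/-- The meshes in one of the two rectangles attached to a pair of crossing chords are all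
constrained, since a triangulation cannot contain chords connecting both pairs of opposite
sides. -/
theorem rectangle_constrained {n : ℕ} [NeZero n] (T : Triangulation n) {i j k l : ℕ}
    (hij : i < j) (hl : l < n) :
    (∀ p ∈ Finset.Ico i j, ∀ q ∈ Finset.Ico k l,
      IsConstrained T (Fin.ofNat n p) (Fin.ofNat n q)) ∨
    (∀ p ∈ Finset.Ico j k, ∀ q ∈ Finset.Ico l (i + n),
      IsConstrained T (Fin.ofNat n p) (Fin.ofNat n q)) := by
  by_contra! hcon
  obtain ⟨⟨p, hp, q, hq, h1⟩, p', hp', q', hq', h2⟩ := hcon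
  rw [Finset.mem_Ico] at hp hq hp' hq'
  have vlt : ∀ m, m < n → (Fin.ofNat n m).val = m := fun m hm => Nat.mod_eq_of_lt hm
  have vge : ∀ m, n ≤ m → m < 2 * n → (Fin.ofNat n m).val = m - n := fun m hm hm' => by
    change m % n = _
    rw [Nat.mod_eq_sub_mod hm, Nat.mod_eq_of_lt (by omega)]
  -- The bad meshes yield chords of `T` with ends in `(i,j]`, `(k,l]` and in `(j,k]`, `(l,i+n]`
  -- respectively; these four ends alternate around the polygon.
  have m1 : T.Mem (Fin.ofNat n (p + 1)) (Fin.ofNat n (q + 1)) := by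
    rw [ofNat_succ, ofNat_succ]
    refine (isConstrained_or_mem T ?_ ?_ ?_).resolve_left h1 <;>
    · simp only [← ofNat_succ, Ne, Fin.ext_iff]
      rw [vlt _ (by omega), vlt _ (by omega)]
      omega
  have m2 : T.Mem (Fin.ofNat n (p' + 1)) (Fin.ofNat n (q' + 1)) := by
    rw [ofNat_succ, ofNat_succ]
    have e1 := vlt p' (by omega)
    have e2 := vlt (p' + 1) (by omega)
    have e3 := vlt q'
    have e4 := vge q'
    have e5 := vlt (q' + 1)
    have e6 := vge (q' + 1)
    refine (isConstrained_or_mem T ?_ ?_ ?_).resolve_left h2 <;>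
    · simp only [← ofNat_succ, Ne, Fin.ext_iff]
      omega
  refine not_mem_cross T m1 m2 ?_ ?_ ?_ <;> simp only [Fin.lt_def]
  · rw [vlt _ (by omega), vlt _ (by omega)]; omega
  · rw [vlt _ (by omega), vlt _ (by omega)]; omega
  · rw [vlt (p + 1) (by omega), vlt (q + 1) (by omega)]
    rcases lt_or_ge (q' + 1) n with h' | h'
    · rw [vlt _ h']; omega
    · rw [vge _ h' (by omega)]; omega

/-- The exchange relations. -/
theorem exchange {n : ℕ} [NeZero n] (T : Triangulation n) {i j k l : Fin n}
    (hij : i < j) (hjk : j < k) (hkl : k < l) :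
    ((∀ w ∈ meshKernel T, planar w i k + planar w j l = planar w i l + planar w j k) ∧
      ∀ c : PosConst n, ∀ x ∈ associahedron T c,
        planar x i l + planar x j k < planar x i k + planar x j l) ∨
    ((∀ w ∈ meshKernel T, planar w i k + planar w j l = planar w i j + planar w k l) ∧
      ∀ c : PosConst n, ∀ x ∈ associahedron T c,
        planar x i j + planar x k l < planar x i k + planar x j l) := by
  have cast : ∀ m : Fin n, Fin.ofNat n m.val = m := fun m =>
    Fin.ext (Nat.mod_eq_of_lt m.isLt)
  have castn : Fin.ofNat n (i.val + n) = i := Fin.ext (by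
    change (i.val + n) % n = _
    rw [Nat.add_mod_right, Nat.mod_eq_of_lt i.isLt])
  rw [Fin.lt_def] at hij hjk hkl
  have hn := l.isLt
  refine (rectangle_constrained T (k := k.val) hij l.isLt).imp (fun h => ?_) (fun h => ?_)
  · have key := fun x : Chord n → ℝ => sum_rectangle x hij.le hkl.le
    simp only [cast] at key
    refine ⟨fun w hw => ?_, fun c x hx => ?_⟩
    · have := key w
      rw [Finset.sum_eq_zero fun p hp => Finset.sum_eq_zero fun q hq => ?_] at this
      · linarith
      obtain ⟨a, ha, ha'⟩ := h p hp q hq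
      rw [ha', hw a ha]
    · have := key x
      have neg : ∑ p ∈ Finset.Ico i.val j.val, ∑ q ∈ Finset.Ico k.val l.val,
          mandelstam x (Fin.ofNat n p) (Fin.ofNat n q) < 0 := by
        refine Finset.sum_neg (fun p hp => Finset.sum_neg (fun q hq => ?_) ?_) ?_
        · obtain ⟨a, ha, ha'⟩ := h p hp q hq
          rw [ha', hx.2 a ha]
          linarith [c.pos a]
        · exact Finset.nonempty_Ico.2 hkl
        · exact Finset.nonempty_Ico.2 hij
      linarith
  -- The second rectangle ends at `i + n`, which represents the vertex `i` again.
  · have key := fun x : Chord n → ℝ =>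
      sum_rectangle x hjk.le (show l.val ≤ i.val + n by omega)
    simp only [cast, castn] at key
    refine ⟨fun w hw => ?_, fun c x hx => ?_⟩
    · have := key w
      rw [Finset.sum_eq_zero fun p hp => Finset.sum_eq_zero fun q hq => ?_] at this
      · rw [planar_comm w j i, planar_comm w k i] at this
        linarith
      obtain ⟨a, ha, ha'⟩ := h p hp q hq
      rw [ha', hw a ha]
    · have := key x
      have neg : ∑ p ∈ Finset.Ico j.val k.val, ∑ q ∈ Finset.Ico l.val (i.val + n),
          mandelstam x (Fin.ofNat n p) (Fin.ofNat n q) < 0 := by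
        refine Finset.sum_neg (fun p hp => Finset.sum_neg (fun q hq => ?_) ?_) ?_
        · obtain ⟨a, ha, ha'⟩ := h p hp q hq
          rw [ha', hx.2 a ha]
          linarith [c.pos a]
        · exact Finset.nonempty_Ico.2 (by omega)
        · exact Finset.nonempty_Ico.2 hjk
      rw [planar_comm x j i, planar_comm x k i] at this
      linarith

theorem planar_nonneg {n : ℕ} {x : Chord n → ℝ} (hx : ∀ a, 0 ≤ x a) (i j : Fin n) :
    0 ≤ planar x i j := by
  unfold planar; split_ifs <;> simp [hx]

/-- The facets of two crossing chords are disjoint. -/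
theorem add_pos_of_crosses {n : ℕ} [NeZero n] {T : Triangulation n} {c : PosConst n}
    {x : EmbeddingSpace n} (hx : x ∈ associahedron T c) {a b : Chord n} (hab : a.Crosses b) :
    0 < x a + x b := by
  have main : ∀ a b : Chord n, a.fst < b.fst → b.fst < a.snd → a.snd < b.snd →
      0 < x a + x b := by
    intro a b h1 h2 h3
    rw [← planar_chord x a, ← planar_chord x b]
    have p := planar_nonneg hx.1
    rcases exchange T h1 h2 h3 with h | h
    · linarith [h.2 c x hx, p a.fst b.snd, p b.fst a.snd]
    · linarith [h.2 c x hx, p a.fst b.fst, p a.snd b.snd]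
  rcases hab with ⟨h1, h2, h3⟩ | ⟨h1, h2, h3⟩
  · exact main a b h1 h2 h3
  · rw [add_comm]; exact main b a h1 h2 h3

theorem not_crosses_of_zero {n : ℕ} [NeZero n] {T : Triangulation n} {c : PosConst n}
    {x : EmbeddingSpace n} (hx : x ∈ associahedron T c) {a b : Chord n} (ha : x a = 0)
    (hb : x b = 0) : ¬ a.Crosses b := fun h => by
  have := add_pos_of_crosses hx h
  rw [ha, hb] at this
  simp at this


/-! ### The chords of a triangulation as coordinates -/

theorem Triangulation.exists_crosses {n : ℕ} (T : Triangulation n) {b : Chord n}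
    (hb : b ∉ T.chords) : ∃ a ∈ T.chords, b.Crosses a := by
  by_contra! h
  exact hb (T.maximal b h)

/-- Induction on the number of chords of `T'` crossing `b`. If `a ∈ T'` crosses `b`, each side of
their quadrilateral is crossed by fewer chords of `T'`: those crossing a side do not cross `a`,
hence cross `b`, while `a` itself crosses `b` but no side. So `w` vanishes on the sides, and the
exchange relation leaves `w a + w b = 0`. -/
theorem eq_zero_of_zero_on {n : ℕ} [NeZero n] {T T' : Triangulation n} {w : EmbeddingSpace n}
    (hw : w ∈ meshKernel T) (h0 : ∀ a ∈ T'.chords, w a = 0) : w = 0 := by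
  classical
  have main : ∀ (N : ℕ) (b : Chord n), (T'.chords.filter (fun c => c.Crosses b)).card = N →
      w b = 0 := by
    intro N
    induction N using Nat.strong_induction_on with
    | _ N ih =>
    intro b hN
    by_cases hb : b ∈ T'.chords
    · exact h0 b hb
    obtain ⟨a, ha, hab⟩ := T'.exists_crosses hb
    have side : ∀ u v : Fin n, u < v →
        (∀ h, ¬ a.Crosses ⟨u, v, h⟩ ∧ ∀ c : Chord n, ¬ c.Crosses a → c.Crosses ⟨u, v, h⟩ →
          c.Crosses b) → planar w u v = 0 := by
      intro u v huv h
      by_cases hc : u.val + 1 < v.val ∧ ¬(u.val = 0 ∧ v.val + 1 = n)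
      · refine (planar_chord w ⟨u, v, hc⟩).trans (ih _ ?_ _ rfl)
        rw [← hN]
        refine Finset.card_lt_card (Finset.ssubset_iff_of_subset ?_ |>.2 ⟨a, ?_, ?_⟩)
        · intro c
          simp only [Finset.mem_filter]
          exact fun hcc => ⟨hcc.1, (h hc).2 c (T'.noncrossing c hcc.1 a ha) hcc.2⟩
        · exact Finset.mem_filter.2 ⟨ha, Chord.crosses_comm.1 hab⟩
        · exact fun hh => (h hc).1 (Finset.mem_filter.1 hh).2
      · unfold planar
        rw [dif_neg hc, dif_neg (by rw [Fin.lt_def] at huv; omega)]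
    have cross : ∀ i j k l : Fin n, i < j → j < k → k < l →
        planar w i j = 0 → planar w j k = 0 → planar w k l = 0 → planar w i l = 0 →
        planar w i k + planar w j l = 0 := by
      intro i j k l h1 h2 h3 e1 e2 e3 e4
      rcases exchange T h1 h2 h3 with h | h <;> rw [h.1 w hw] <;> simp [*]
    have sum0 : w a + w b = 0 := by
      rw [← planar_chord w a, ← planar_chord w b]
      rcases hab with ⟨h1, h2, h3⟩ | ⟨h1, h2, h3⟩
      · rw [add_comm]
        refine cross _ _ _ _ h1 h2 h3 ?_ ?_ ?_ ?_ <;>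
        · refine side _ _ (by simp only [Fin.lt_def] at *; omega) fun h => ⟨?_, fun c => ?_⟩ <;>
          · simp only [Fin.lt_def] at h1 h2 h3
            simp only [Chord.crosses_iff]
            omega
      · refine cross _ _ _ _ h1 h2 h3 ?_ ?_ ?_ ?_ <;>
        · refine side _ _ (by simp only [Fin.lt_def] at *; omega) fun h => ⟨?_, fun c => ?_⟩ <;>
          · simp only [Fin.lt_def] at h1 h2 h3
            simp only [Chord.crosses_iff]
            omega
    rwa [h0 a ha, zero_add] at sum0
  funext b
  exact main _ b rfl

/-- The coordinates `x_a`, `a ∈ T'`, together with the constrained `y_a`, `a ∉ T^c`. -/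
def coordMap {n : ℕ} [NeZero n] (T T' : Triangulation n) :
    EmbeddingSpace n →ₗ[ℝ] (T'.chords → ℝ) × ({a // ¬ T.MemRot a} → ℝ) where
  toFun x := (fun a => x a, fun a => mandelstam x a.1.fst a.1.snd)
  map_add' x y := by
    ext <;> simp [mandelstam_add]
  map_smul' r x := by
    ext <;> simp [mandelstam_smul]

theorem coordMap_injective {n : ℕ} [NeZero n] (T T' : Triangulation n) :
    Function.Injective (coordMap T T') := by
  rw [← LinearMap.ker_eq_bot, LinearMap.ker_eq_bot']
  intro w hw
  refine eq_zero_of_zero_on (T := T) (T' := T') (fun a ha => ?_) (fun a ha => ?_)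
  · exact congrFun (congrArg Prod.snd hw) ⟨a, ha⟩
  · exact congrFun (congrArg Prod.fst hw) ⟨a, ha⟩

/-- The chord rotated back by one step. -/
def Chord.rotBack {n : ℕ} (a : Chord n) : Chord n :=
  -- Vertex `0` rotates back to `n - 1`, which becomes the larger end.
  if h : a.fst.val = 0 then
    ⟨⟨a.snd.val - 1, by omega⟩, ⟨n - 1, by omega⟩, by have := a.isChord; simp only; omega⟩
  else
    ⟨⟨a.fst.val - 1, by omega⟩, ⟨a.snd.val - 1, by omega⟩, by
      have := a.isChord; simp only; omega⟩

theorem Chord.rotBack_injective {n : ℕ} : Function.Injective (Chord.rotBack (n := n)) := by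
  intro a b h
  have h1 := congrArg (fun c : Chord n => c.fst.val) h
  have h2 := congrArg (fun c : Chord n => c.snd.val) h
  have := a.isChord
  have := b.isChord
  have := a.snd.isLt
  have := b.snd.isLt
  refine Chord.ext_val ?_ ?_ <;>
  · unfold Chord.rotBack at h1 h2
    split_ifs at h1 h2 <;> simp only at h1 h2 <;> omega

theorem Triangulation.memRot_rotBack {n : ℕ} [NeZero n] {T : Triangulation n} {a : Chord n}
    (ha : a ∈ T.chords) : T.MemRot a.rotBack := by
  have e1 := val_add_one a.rotBack.fst
  have e2 := val_add_one a.rotBack.snd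
  have := a.isChord
  have := a.snd.isLt
  refine ⟨a, ha, ?_⟩
  simp only [Fin.ext_iff, e1, e2]
  unfold Chord.rotBack
  split_ifs <;> simp only at * <;> omega

open Classical in
theorem card_coordMap_target {n : ℕ} [NeZero n] (T T' : Triangulation n) :
    Module.finrank ℝ ((T'.chords → ℝ) × ({a // ¬ T.MemRot a} → ℝ)) +
      Fintype.card {a // T.MemRot a} = T'.chords.card + Fintype.card (Chord n) := by
  rw [Module.finrank_prod, Module.finrank_fintype_fun_eq_card, Module.finrank_fintype_fun_eq_card,
    Fintype.card_subtype_compl, Fintype.card_coe]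
  have := Fintype.card_subtype_le (fun a => T.MemRot a)
  omega

-- Injectivity of `coordMap` bounds the dimension of its source, the number of chords, by `|T'|`
-- plus the number of constrained chords.
open Classical in
theorem card_memRot_le {n : ℕ} [NeZero n] (T T' : Triangulation n) :
    Fintype.card {a // T.MemRot a} ≤ T'.chords.card := by
  have h := LinearMap.finrank_le_finrank_of_injective (coordMap_injective T T')
  have h' := card_coordMap_target T T'
  rw [Module.finrank_fintype_fun_eq_card] at h
  omega

open Classical in
theorem card_le_card_memRot {n : ℕ} [NeZero n] (T : Triangulation n) :
    T.chords.card ≤ Fintype.card {a // T.MemRot a} := by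
  rw [← Fintype.card_coe]
  exact Fintype.card_le_of_injective
    (fun a : T.chords => (⟨a.1.rotBack, Triangulation.memRot_rotBack a.2⟩ : {a // T.MemRot a}))
    fun a b h => Subtype.ext (Chord.rotBack_injective (congrArg Subtype.val h))

/-- The chain `|T| ≤ |T^c| ≤ |T'|` holds for all pairs, so swapping `T` and `T'` closes it. Both
sides of `coordMap` therefore have the same dimension. -/
theorem card_chords_eq {n : ℕ} [NeZero n] (T T' : Triangulation n) :
    T.chords.card = T'.chords.card :=
  le_antisymm ((card_le_card_memRot T).trans (card_memRot_le T T'))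
    ((card_le_card_memRot T').trans (card_memRot_le T' T))

theorem coordMap_surjective {n : ℕ} [NeZero n] (T T' : Triangulation n) :
    Function.Surjective (coordMap T T') := by
  classical
  refine (LinearMap.injective_iff_surjective_of_finrank_eq_finrank ?_).1 (coordMap_injective T T')
  have h' := card_coordMap_target T T'
  have h1 := card_memRot_le T T'
  have h2 := card_le_card_memRot T
  have h3 := card_chords_eq T T'
  rw [Module.finrank_fintype_fun_eq_card]
  omega

/-- Source of all later witnesses: edge directions, deformations of the constants, and dual bases to
the chords of a triangulation. -/
theorem exists_coords {n : ℕ} [NeZero n] (T T' : Triangulation n) (u r : Chord n → ℝ) :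
    ∃ x : EmbeddingSpace n, (∀ a ∈ T'.chords, x a = u a) ∧
      ∀ a, ¬ T.MemRot a → mandelstam x a.fst a.snd = r a := by
  obtain ⟨x, hx⟩ := coordMap_surjective T T' (fun a => u a, fun a => r a)
  exact ⟨x, fun a ha => congrFun (congrArg Prod.fst hx) ⟨a, ha⟩,
    fun a ha => congrFun (congrArg Prod.snd hx) ⟨a, ha⟩⟩


/-! ### Flips -/

/-- A functional which is zero or one of the coordinates `x_d`, `d ∈ S`. -/
def IsSide {n : ℕ} (S : Finset (Chord n)) (β : Module.Dual ℝ (EmbeddingSpace n)) : Prop :=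
  β = 0 ∨ ∃ d ∈ S, β = coord d

/-- `T'` arises from `T` by exchanging the diagonals `a` and `b` of a quadrilateral. -/
structure IsFlip {n : ℕ} [NeZero n] (T T' : Triangulation n) (a b : Chord n) : Prop where
  mem : a ∈ T.chords
  notMem : b ∉ T.chords
  chords_eq : T'.chords = insert b (T.chords.erase a)
  -- Once `a` is removed, the only gap is a quadrilateral, with just two diagonals.
  eq_of_not_crosses : ∀ c, (∀ d ∈ T.chords.erase a, ¬ c.Crosses d) → c ∈ T.chords ∨ c = b
  -- Which pair of opposite sides occurs depends on `T₀`; the coefficient of `w a` does not, and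
  -- this fixes the sign.
  exchange : ∀ T₀ : Triangulation n, ∃ β γ : Module.Dual ℝ (EmbeddingSpace n),
    IsSide (T.chords.erase a) β ∧ IsSide (T.chords.erase a) γ ∧
      ∀ w ∈ meshKernel T₀, w a + w b = β w + γ w

theorem IsFlip.erase_eq {n : ℕ} [NeZero n] {T T' : Triangulation n} {a b : Chord n}
    (h : IsFlip T T' a b) : T'.chords.erase b = T.chords.erase a := by
  rw [h.chords_eq, Finset.erase_insert]
  exact fun hb => h.notMem (Finset.mem_of_mem_erase hb)

theorem IsFlip.symm {n : ℕ} [NeZero n] {T T' : Triangulation n} {a b : Chord n}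
    (h : IsFlip T T' a b) : IsFlip T' T b a where
  mem := by rw [h.chords_eq]; exact Finset.mem_insert_self _ _
  notMem := by
    rw [h.chords_eq, Finset.mem_insert, not_or]
    exact ⟨fun e => h.notMem (e ▸ h.mem), Finset.notMem_erase _ _⟩
  chords_eq := by rw [h.erase_eq, Finset.insert_erase h.mem]
  eq_of_not_crosses := fun c hc => by
    rw [h.erase_eq] at hc
    rw [h.chords_eq, Finset.mem_insert, Finset.mem_erase]
    have := h.eq_of_not_crosses c hc
    tauto
  exchange := fun T₀ => by
    rw [h.erase_eq]
    obtain ⟨β, γ, hβ, hγ, h'⟩ := h.exchange T₀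
    exact ⟨β, γ, hβ, hγ, fun w hw => by rw [add_comm, h' w hw]⟩

/-- The fan triangulation at the vertex `0`. -/
noncomputable def fan (n : ℕ) : Triangulation n where
  chords := Finset.univ.filter fun a => a.fst.val = 0
  noncrossing a ha b hb := by
    simp only [Finset.mem_filter, Finset.mem_univ, true_and] at ha hb
    simp only [Chord.crosses_iff]
    omega
  maximal a h := by
    simp only [Finset.mem_filter, Finset.mem_univ, true_and] at h ⊢
    by_contra h0
    have h1 := a.isChord
    have h2 := a.snd.isLt
    refine h ⟨⟨0, by omega⟩, ⟨a.fst.val + 1, by omega⟩, by simp only; omega⟩ rfl ?_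
    simp only [Chord.crosses_iff]
    omega

theorem mem_fan {n : ℕ} {a : Chord n} : a ∈ (fan n).chords ↔ a.fst.val = 0 := by
  simp [fan]

theorem card_fan {n : ℕ} : (fan n).chords.card = n - 3 := by
  have : (fan n).chords.card = (Finset.Ico 2 (n - 1)).card := by
    refine Finset.card_bij (fun a _ => a.snd.val) ?_ ?_ ?_
    · intro a ha
      rw [mem_fan] at ha
      have h1 := a.isChord
      have h2 := a.snd.isLt
      rw [Finset.mem_Ico]; omega
    · intro a ha b hb h
      rw [mem_fan] at ha hb
      exact Chord.ext_val (ha.trans hb.symm) h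
    · intro k hk
      rw [Finset.mem_Ico] at hk
      exact ⟨⟨⟨0, by omega⟩, ⟨k, by omega⟩, by simp only; omega⟩, mem_fan.2 rfl, rfl⟩
  rw [this, Nat.card_Ico]; omega

theorem card_chords {n : ℕ} [NeZero n] (T : Triangulation n) : T.chords.card = n - 3 :=
  (card_chords_eq T (fan n)).trans card_fan

/-- `i < j` are the ends of a side of the polygon or of a chord in `S`. -/
def IsEdge {n : ℕ} (S : Finset (Chord n)) (i j : ℕ) : Prop :=
  i + 1 = j ∨ (i = 0 ∧ j + 1 = n) ∨ ∃ d ∈ S, d.fst.val = i ∧ d.snd.val = j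

theorem Triangulation.isEdge {n : ℕ} (T : Triangulation n) {i j : ℕ} (hij : i < j) (hj : j < n)
    (h : ∀ d ∈ T.chords, ¬ ((i < d.fst.val ∧ d.fst.val < j ∧ j < d.snd.val) ∨
      (d.fst.val < i ∧ i < d.snd.val ∧ d.snd.val < j))) : IsEdge T.chords i j := by
  by_cases hc : i + 1 < j ∧ ¬(i = 0 ∧ j + 1 = n)
  · refine Or.inr (Or.inr ⟨⟨⟨i, by omega⟩, ⟨j, hj⟩, hc⟩, T.maximal _ fun b hb => ?_, rfl, rfl⟩)
    rw [Chord.crosses_iff]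
    exact h b hb
  · unfold IsEdge; omega

theorem IsEdge.not_crosses {n : ℕ} {S : Finset (Chord n)} {i j : ℕ} (h : IsEdge S i j)
    {c : Chord n} (hc : ∀ d ∈ S, ¬ c.Crosses d) :
    ¬ ((i < c.fst.val ∧ c.fst.val < j ∧ j < c.snd.val) ∨
      (c.fst.val < i ∧ i < c.snd.val ∧ c.snd.val < j)) := by
  have h1 := c.isChord
  have h2 := c.snd.isLt
  rcases h with h | h | ⟨d, hd, hi, hj⟩
  · omega
  · omega
  · have := hc d hd
    rw [Chord.crosses_iff] at this
    omega

theorem IsEdge.erase {n : ℕ} {S : Finset (Chord n)} {i j : ℕ} (h : IsEdge S i j) {a : Chord n}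
    (ha : ¬ (a.fst.val = i ∧ a.snd.val = j)) : IsEdge (S.erase a) i j := by
  rcases h with h | h | ⟨d, hd, hi, hj⟩
  · exact Or.inl h
  · exact Or.inr (Or.inl h)
  · exact Or.inr (Or.inr ⟨d, Finset.mem_erase.2 ⟨fun e => ha (e ▸ ⟨hi, hj⟩), hd⟩, hi, hj⟩)

theorem IsEdge.exists_isSide {n : ℕ} {S : Finset (Chord n)} {i j : Fin n}
    (h : IsEdge S i.val j.val) :
    ∃ β, IsSide S β ∧ ∀ w : EmbeddingSpace n, planar w i j = β w := by
  by_cases hc : ∃ d ∈ S, d.fst.val = i.val ∧ d.snd.val = j.val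
  · obtain ⟨d, hd, hi, hj⟩ := hc
    refine ⟨coord d, Or.inr ⟨d, hd, rfl⟩, fun w => ?_⟩
    rw [← Fin.ext hi, ← Fin.ext hj, planar_chord]
    rfl
  · refine ⟨0, Or.inl rfl, fun w => ?_⟩
    have h' := h.imp_right fun h => h.resolve_right hc
    unfold planar
    rw [dif_neg (by omega), dif_neg (by omega)]
    rfl

/-- A triangulation other than the fan at `0` can be flipped so as to increase the degree
of `0`. -/
theorem exists_flip {n : ℕ} [NeZero n] (T : Triangulation n)
    (hT : ∃ a ∈ T.chords, a.fst.val ≠ 0) :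
    ∃ T' a b, IsFlip T T' a b ∧ a.fst.val ≠ 0 ∧ b.fst.val = 0 := by
  -- Take a longest chord avoiding `0`. A chord crossing `(0, a.fst)` or `(0, a.snd)` without
  -- crossing `a` would be longer, so `0` is the apex of the triangle on the outer side of `a`.
  obtain ⟨a, ha, hmax⟩ := Finset.exists_max_image (T.chords.filter fun a => a.fst.val ≠ 0)
    (fun a => a.snd.val - a.fst.val)
    (by obtain ⟨a, ha⟩ := hT; exact ⟨a, Finset.mem_filter.2 ha⟩)
  rw [Finset.mem_filter] at ha
  obtain ⟨ha, ha0⟩ := ha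
  simp only [Finset.mem_filter, and_imp] at hmax
  have hch := a.isChord
  have hlt := a.snd.isLt
  have e1 : IsEdge T.chords 0 a.fst.val := T.isEdge (by omega) (by omega) fun d hd => by
    have h1 := hmax d hd
    have h2 := T.noncrossing a ha d hd
    rw [Chord.crosses_iff] at h2
    omega
  have e2 : IsEdge T.chords 0 a.snd.val := T.isEdge (by omega) (by omega) fun d hd => by
    have h1 := hmax d hd
    have h2 := T.noncrossing a ha d hd
    rw [Chord.crosses_iff] at h2
    omega
  classical
  -- The apex `m` of the triangle on the inner side of `a`: the last vertex before `a.snd` joined to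
  -- `a.fst`. The polygon side ending at `a.fst + 1` makes the choice possible.
  obtain ⟨m, hm, hmmax⟩ := Finset.exists_max_image
    ((Finset.Ioo a.fst.val a.snd.val).filter fun m => IsEdge T.chords a.fst.val m) id
    ⟨a.fst.val + 1, Finset.mem_filter.2 ⟨Finset.mem_Ioo.2 ⟨by omega, by omega⟩, Or.inl rfl⟩⟩
  simp only [Finset.mem_filter, Finset.mem_Ioo, id, and_imp] at hm hmmax
  obtain ⟨⟨hjm, hml⟩, e3⟩ := hm
  have e4 : IsEdge T.chords m a.snd.val := T.isEdge hml (by omega) fun d hd => by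
    have h1 := e3.not_crosses (T.noncrossing d hd)
    have h2 := T.noncrossing a ha d hd
    have h3 := d.isChord
    rw [Chord.crosses_iff] at h2
    intro h
    -- A chord crossing `(m, a.snd)` but not `a` either starts at `a.fst`, against maximality of
    -- `m`, or crosses the edge `(a.fst, m)`.
    by_cases hd' : d.fst.val = a.fst.val
    · have := hmmax d.snd.val (by omega) (by omega) (Or.inr (Or.inr ⟨d, hd, hd', rfl⟩))
      omega
    · omega
  have s1 := e1.erase (a := a) (by omega)
  have s2 := e2.erase (a := a) (by omega)
  have s3 := e3.erase (a := a) (by omega)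
  have s4 := e4.erase (a := a) (by omega)
  set b : Chord n := ⟨⟨0, by omega⟩, ⟨m, by omega⟩, by simp only; omega⟩ with hb
  have bf : b.fst.val = 0 := rfl
  have bs : b.snd.val = m := rfl
  have hab : a.Crosses b := by
    rw [Chord.crosses_iff]; omega
  have eqb : ∀ c, (∀ d ∈ T.chords.erase a, ¬ c.Crosses d) → c ∈ T.chords ∨ c = b := by
    intro c hc
    by_cases hca : c.Crosses a
    · right
      have h1 := s1.not_crosses hc
      have h2 := s2.not_crosses hc
      have h3 := s3.not_crosses hc
      have h4 := s4.not_crosses hc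
      rw [Chord.crosses_iff] at hca
      apply Chord.ext_val <;> omega
    · left
      refine T.maximal c fun d hd => ?_
      by_cases hda : d = a
      · rwa [hda]
      · exact hc d (Finset.mem_erase.2 ⟨hda, hd⟩)
  have hbT : ∀ d ∈ T.chords.erase a, ¬ d.Crosses b := by
    intro d hd hdb
    obtain ⟨hda, hd⟩ := Finset.mem_erase.1 hd
    have hc := T.noncrossing d hd
    have h1 := e1.not_crosses hc
    have h2 := e2.not_crosses hc
    have h3 := e3.not_crosses hc
    have h4 := e4.not_crosses hc
    rw [Chord.crosses_iff] at hdb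
    exact hda (Chord.ext_val (by omega) (by omega))
  refine ⟨⟨insert b (T.chords.erase a), ?_, ?_⟩, a, b, ⟨ha, ?_, rfl, eqb, fun T₀ => ?_⟩, ha0, rfl⟩
  · intro c hc d hd
    rw [Finset.mem_insert] at hc hd
    rcases hc with rfl | hc <;> rcases hd with rfl | hd
    · simp [Chord.crosses_iff]
    · rw [Chord.crosses_comm]; exact hbT d hd
    · exact hbT c hc
    · exact T.noncrossing c (Finset.mem_of_mem_erase hc) d (Finset.mem_of_mem_erase hd)
  · intro c hc
    simp only [Finset.mem_insert, forall_eq_or_imp] at hc ⊢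
    rcases eqb c hc.2 with h | h
    · refine Or.inr (Finset.mem_erase.2 ⟨?_, h⟩)
      rintro rfl
      exact hc.1 hab
    · exact Or.inl h
  · exact fun hbT => T.noncrossing a ha b hbT hab
  · obtain ⟨β₁, hβ₁, h₁⟩ := IsEdge.exists_isSide (i := b.fst) (j := a.fst) s1
    obtain ⟨β₂, hβ₂, h₂⟩ := IsEdge.exists_isSide (i := b.fst) (j := a.snd) s2
    obtain ⟨β₃, hβ₃, h₃⟩ := IsEdge.exists_isSide (i := a.fst) (j := b.snd) s3
    obtain ⟨β₄, hβ₄, h₄⟩ := IsEdge.exists_isSide (i := b.snd) (j := a.snd) s4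
    have key := ABHY.exchange T₀ (i := b.fst) (j := a.fst) (k := b.snd) (l := a.snd)
      (by rw [Fin.lt_def]; omega) (by rw [Fin.lt_def]; omega) (by rw [Fin.lt_def]; omega)
    simp only [planar_chord, h₁, h₂, h₃, h₄] at key
    rcases key with key | key
    · exact ⟨β₂, β₃, hβ₂, hβ₃, fun w hw => by rw [add_comm]; exact key.1 w hw⟩
    · exact ⟨β₁, β₄, hβ₁, hβ₄, fun w hw => by rw [add_comm]; exact key.1 w hw⟩

/-- All triangulations are connected by flips with the fan. -/
theorem flip_induction {n : ℕ} [NeZero n] {p : Triangulation n → Prop} (h0 : p (fan n))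
    (hflip : ∀ T T' a b, IsFlip T T' a b → p T → p T') (T : Triangulation n) : p T := by
  have main : ∀ (N : ℕ) (T : Triangulation n),
      (T.chords.filter fun a => a.fst.val ≠ 0).card = N → p T := by
    intro N
    induction N with
    | zero =>
      intro T hT
      rw [Finset.card_eq_zero, Finset.filter_eq_empty_iff] at hT
      have : T = fan n := by
        -- With all chords at `0`, `T` is contained in the fan and has the same size.
        have hc : T.chords = (fan n).chords := Finset.eq_of_subset_of_card_le
          (fun a ha => mem_fan.2 (not_not.1 (hT ha))) (card_chords_eq _ _).le
        cases T
        cases h : fan n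
        simp only [h] at hc
        simp only [hc]
      rwa [this]
    | succ N ih =>
      intro T hT
      obtain ⟨a₀, ha₀⟩ := Finset.card_pos.1 (by rw [hT]; omega)
      obtain ⟨T', a, b, hf, ha, hb⟩ := exists_flip T ⟨a₀, Finset.mem_filter.1 ha₀⟩
      refine hflip T' T b a hf.symm (ih T' ?_)
      rw [hf.chords_eq, Finset.filter_insert, if_neg (not_not.2 hb), Finset.filter_erase,
        Finset.card_erase_of_mem (Finset.mem_filter.2 ⟨hf.mem, ha⟩), hT]
      rfl
  exact main _ T rfl


/-! ### Every triangulation is a vertex -/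

/-- Leave `v` in direction `u` and stop when a decreasing coordinate first reaches zero, at the
least ratio `v b / -u b`. A coordinate negative at time `1` forces `t < 1`. -/
theorem exists_first_zero {ι : Type*} [Fintype ι] {v u : ι → ℝ} (hv : ∀ b, 0 ≤ v b)
    (hneg : ∃ b, v b + u b < 0) :
    ∃ t : ℝ, 0 ≤ t ∧ t < 1 ∧ (∀ b, 0 ≤ v b + t * u b) ∧ ∃ b, u b < 0 ∧ v b + t * u b = 0 := by
  obtain ⟨b₀, hb₀⟩ := hneg
  have hu₀ : u b₀ < 0 := by linarith [hv b₀]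
  obtain ⟨b, hb, hmin⟩ := Finset.exists_min_image (Finset.univ.filter fun b => u b < 0)
    (fun b => v b / -u b) ⟨b₀, by simpa using hu₀⟩
  simp only [Finset.mem_filter, Finset.mem_univ, true_and] at hb hmin
  have h0 : 0 ≤ v b / -u b := div_nonneg (hv b) (by linarith)
  refine ⟨v b / -u b, h0, ?_, fun d => ?_, b, hb, ?_⟩
  · refine (hmin b₀ hu₀).trans_lt ?_
    rw [div_lt_one (by linarith)]
    linarith
  · rcases lt_or_ge (u d) 0 with hd | hd
    · have := hmin d hd
      rw [le_div_iff₀ (by linarith)] at this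
      linarith
    · exact add_nonneg (hv d) (mul_nonneg h0 hd)
  · have : u b ≠ 0 := hb.ne
    field_simp
    ring

/-- The triangulation `T'` is (the set of facets through) a point of `A_n^T`. -/
def Realizes {n : ℕ} [NeZero n] (T : Triangulation n) (c : PosConst n) (T' : Triangulation n) :
    Prop :=
  ∃ v ∈ associahedron T c, ∀ a, a ∈ T'.chords ↔ v a = 0

/-- Chords vanishing at a common point of the polytope do not cross, so by maximality of `T'` no
further chord vanishes. -/
theorem realizes_of_zero {n : ℕ} [NeZero n] {T T' : Triangulation n} {c : PosConst n}
    {v : EmbeddingSpace n} (hv : v ∈ associahedron T c) (h : ∀ a ∈ T'.chords, v a = 0) :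
    Realizes T c T' :=
  ⟨v, hv, fun a => ⟨h a, fun ha => T'.maximal a fun b hb => not_crosses_of_zero hv ha (h b hb)⟩⟩

/-- A point at which all the `y_a` are negative, and only the chords of the fan vanish. -/
noncomputable def seed (n : ℕ) : EmbeddingSpace n := fun a =>
  if a.fst.val = 0 then 0
  -- With `d` the length, `(d - 1)(2n - d)` vanishes on sides, is concave in `d`, and increases for
  -- `d ≤ n`; the last property is why `2n` replaces `n`.
  else ((a.snd.val : ℝ) - a.fst.val - 1) * (2 * n - (a.snd.val - a.fst.val))

theorem seed_nonneg {n : ℕ} (a : Chord n) : 0 ≤ seed n a := by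
  unfold seed
  split_ifs
  · exact le_rfl
  · have h1 : ((a.fst.val : ℝ) + 1) < a.snd.val := by exact_mod_cast a.isChord.1
    have h2 : (a.snd.val : ℝ) < n := by exact_mod_cast a.snd.isLt
    have h3 : (0 : ℝ) ≤ a.fst.val := by positivity
    exact mul_nonneg (by linarith) (by linarith)

theorem planar_seed {n : ℕ} {i j : Fin n} (hij : i < j) : planar (seed n) i j =
    if i.val = 0 then 0 else ((j.val : ℝ) - i.val - 1) * (2 * n - (j.val - i.val)) := by
  rw [Fin.lt_def] at hij
  unfold planar
  by_cases h : i.val + 1 < j.val ∧ ¬(i.val = 0 ∧ j.val + 1 = n)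
  · rw [dif_pos h]; rfl
  · rw [dif_neg h, dif_neg (by omega)]
    split_ifs with h0
    · rfl
    · have : j.val = i.val + 1 := by omega
      rw [this]; push_cast; ring

/-- Meshes not involving vertex `0` see the second difference `-2` of `(d - 1)(2n - d)`. Those
touching `0` see minus a first difference of this increasing function. -/
theorem mandelstam_seed_neg {n : ℕ} [NeZero n] (a : Chord n) :
    mandelstam (seed n) a.fst a.snd < 0 := by
  have hc := a.isChord
  have hl := a.snd.isLt
  have e1 := val_add_one a.fst
  have e2 := val_add_one a.snd
  rw [if_neg (by omega)] at e1
  have h1 : ((a.fst.val : ℝ) + 1) < a.snd.val := by exact_mod_cast hc.1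
  have h2 : (a.snd.val : ℝ) < n := by exact_mod_cast hl
  have h3 : (0 : ℝ) ≤ a.fst.val := by positivity
  have q1 := planar_seed (i := a.fst + 1) (j := a.snd) (by rw [Fin.lt_def]; omega)
  have q2 := planar_seed (i := a.fst) (j := a.snd) (by rw [Fin.lt_def]; omega)
  rw [if_neg (by omega), e1] at q1
  unfold mandelstam
  rw [q1, q2]
  by_cases hs : a.snd.val + 1 = n
  · rw [if_pos hs] at e2
    rw [planar_comm _ a.fst, planar_comm _ (a.fst + 1), planar_seed (by rw [Fin.lt_def]; omega),
      planar_seed (by rw [Fin.lt_def]; omega), if_pos e2, if_pos e2, if_neg (by omega)]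
    have hs' : (n : ℝ) = a.snd.val + 1 := by exact_mod_cast hs.symm
    rw [hs']
    push_cast
    nlinarith
  · rw [if_neg hs] at e2
    have q3 := planar_seed (i := a.fst) (j := a.snd + 1) (by rw [Fin.lt_def]; omega)
    have q4 := planar_seed (i := a.fst + 1) (j := a.snd + 1) (by rw [Fin.lt_def]; omega)
    rw [if_neg (by omega), e1, e2] at q4
    rw [q3, q4, e2]
    push_cast
    split_ifs with h0
    · rw [h0]; push_cast; nlinarith
    · nlinarith

theorem mandelstam_add_smul {n : ℕ} [NeZero n] (x u : Chord n → ℝ) (t : ℝ) (i j : Fin n) :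
    mandelstam (x + t • u) i j = mandelstam x i j + t * mandelstam u i j := by
  rw [mandelstam_add, mandelstam_smul]

/-- The seed is the fan vertex for the constants `-mandelstam (seed n)`. Deform these linearly to
`c`, keeping the fan chords at zero. All intermediate constants are positive, so no other chord can
reach zero on the way: it would cross a fan chord. -/
theorem realizes_fan {n : ℕ} [NeZero n] (T : Triangulation n) (c : PosConst n) :
    Realizes T c (fan n) := by
  obtain ⟨u, hu0, hu⟩ := exists_coords T (fan n) 0
    (fun a => -c.val a - mandelstam (seed n) a.fst a.snd)
  have seed0 : ∀ a ∈ (fan n).chords, seed n a = 0 := fun a ha => if_pos (mem_fan.1 ha)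
  have zero : ∀ t : ℝ, ∀ a ∈ (fan n).chords, (seed n + t • u) a = 0 := fun t a ha => by
    simp [seed0 a ha, hu0 a ha]
  have mem : ∀ t : ℝ, ∀ ht0 : 0 ≤ t, ∀ ht1 : t ≤ 1, (∀ b, 0 ≤ seed n b + t * u b) →
      ∃ c' : PosConst n, c'.val = (fun a => (1 - t) * -mandelstam (seed n) a.fst a.snd
        + t * c.val a) ∧ seed n + t • u ∈ associahedron T c' := by
    intro t ht0 ht1 hpos
    refine ⟨⟨_, fun a => ?_⟩, rfl, hpos, fun a ha => ?_⟩
    · have h1 := mandelstam_seed_neg a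
      have h2 := c.pos a
      rcases ht0.eq_or_lt with rfl | ht
      · linarith
      · have := mul_pos ht h2
        have := mul_nonneg (sub_nonneg.2 ht1) (neg_nonneg.2 h1.le)
        linarith
    · rw [mandelstam_add_smul, hu a ha]; ring
  by_cases hneg : ∃ b, seed n b + u b < 0
  · exfalso
    obtain ⟨t, ht0, ht1, hpos, b, hub, hb⟩ := exists_first_zero seed_nonneg hneg
    obtain ⟨c', -, hx⟩ := mem t ht0 ht1.le hpos
    have hbf : b ∉ (fan n).chords := fun h => by
      have := hu0 b h
      simp only [Pi.zero_apply] at this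
      linarith
    obtain ⟨a, ha, hab⟩ := (fan n).exists_crosses hbf
    exact not_crosses_of_zero hx hb (zero t a ha) hab
  · push Not at hneg
    obtain ⟨c', hc', hx⟩ := mem 1 zero_le_one le_rfl (by simpa using hneg)
    have : c' = c := by
      cases c'; cases c
      simp only [PosConst.mk.injEq]
      simpa using hc'
    exact realizes_of_zero (this ▸ hx) (zero 1)

theorem IsSide.apply_eq_zero {n : ℕ} {S : Finset (Chord n)}
    {β : Module.Dual ℝ (EmbeddingSpace n)} (h : IsSide S β) {w : EmbeddingSpace n}
    (hw : ∀ d ∈ S, w d = 0) : β w = 0 := by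
  rcases h with rfl | ⟨d, hd, rfl⟩
  · rfl
  · exact hw d hd

/-- Follow the edge leaving the vertex `T₁` on which only `x_a`, among the chords of `T₁`, grows.
The exchange relation makes `x_b` decrease at the same rate. A coordinate vanishing earlier would
belong to a chord compatible with `T₁ \ {a}`, hence in `T₁` or equal to `b`, and neither can happen.
-/
theorem IsFlip.realizes {n : ℕ} [NeZero n] {T T₁ T₂ : Triangulation n} {c : PosConst n}
    {a b : Chord n} (h : IsFlip T₁ T₂ a b) (h₁ : Realizes T c T₁) : Realizes T c T₂ := by
  obtain ⟨v, hv, hv0⟩ := h₁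
  have hva : v a = 0 := (hv0 a).1 h.mem
  have hvb : 0 < v b := lt_of_le_of_ne (hv.1 b) fun e => h.notMem ((hv0 b).2 e.symm)
  have hba : b ≠ a := fun e => h.notMem (e ▸ h.mem)
  -- The speed `v b` makes `x_b` reach zero exactly at time `1`.
  obtain ⟨w, hw0, hw⟩ := exists_coords T T₁ (fun d => if d = a then v b else 0) 0
  have hwa : w a = v b := by rw [hw0 a h.mem, if_pos rfl]
  have hwS : ∀ d ∈ T₁.chords.erase a, w d = 0 := fun d hd => by
    rw [hw0 d (Finset.mem_of_mem_erase hd), if_neg (Finset.ne_of_mem_erase hd)]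
  have hwb : w b = -v b := by
    obtain ⟨β, γ, hβ, hγ, h'⟩ := h.exchange T
    have := h' w hw
    rw [hβ.apply_eq_zero hwS, hγ.apply_eq_zero hwS] at this
    linarith
  have mem : ∀ t : ℝ, (∀ d, 0 ≤ v d + t * w d) → v + t • w ∈ associahedron T c :=
    fun t ht => ⟨ht, fun d hd => by
      rw [mandelstam_add_smul, hv.2 d hd, hw d hd]; simp⟩
  have zero : ∀ t : ℝ, ∀ d ∈ T₁.chords.erase a, (v + t • w) d = 0 := fun t d hd => by
    simp [hwS d hd, (hv0 d).1 (Finset.mem_of_mem_erase hd)]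
  by_cases hneg : ∃ d, v d + w d < 0
  · exfalso
    obtain ⟨t, ht0, ht1, hpos, d, hwd, hd⟩ := exists_first_zero hv.1 hneg
    have hdT : d ∉ T₁.chords := fun hd => by
      rw [hw0 d hd] at hwd
      split_ifs at hwd <;> linarith
    rcases h.eq_of_not_crosses d
      (fun e he => not_crosses_of_zero (mem t hpos) hd (zero t e he)) with hd' | rfl
    · exact hdT hd'
    · rw [hwb] at hd
      nlinarith
  · push Not at hneg
    refine realizes_of_zero (mem 1 (by simpa using hneg)) fun d hd => ?_
    rw [h.chords_eq, Finset.mem_insert] at hd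
    rcases hd with rfl | hd
    · simp [hwb]
    · exact zero 1 d hd

theorem realizes {n : ℕ} [NeZero n] (T : Triangulation n) (c : PosConst n)
    (T' : Triangulation n) : Realizes T c T' :=
  flip_induction (p := Realizes T c) (realizes_fan T c) (fun _ _ _ _ h => h.realizes) T'

/-! ### The vertices and the affine span -/

theorem sub_mem_meshKernel {n : ℕ} [NeZero n] {T : Triangulation n} {c : PosConst n}
    {x y : EmbeddingSpace n} (hx : x ∈ associahedron T c) (hy : y ∈ associahedron T c) :
    x - y ∈ meshKernel T := fun a ha => by
  have : x - y = x + (-1 : ℝ) • y := by rw [neg_one_smul, sub_eq_add_neg]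
  rw [this, mandelstam_add_smul, hx.2 a ha, hy.2 a ha]
  ring

theorem exists_triangulation_of_noncrossing {n : ℕ} (S : Finset (Chord n))
    (hS : ∀ a ∈ S, ∀ b ∈ S, ¬ a.Crosses b) : ∃ T : Triangulation n, S ⊆ T.chords := by
  classical
  obtain ⟨M, hM, hmax⟩ := Finset.exists_max_image
    (Finset.univ.filter fun M : Finset (Chord n) =>
      S ⊆ M ∧ ∀ a ∈ M, ∀ b ∈ M, ¬ a.Crosses b) Finset.card ⟨S, by simpa using hS⟩
  simp only [Finset.mem_filter, Finset.mem_univ, true_and, and_imp] at hM hmax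
  refine ⟨⟨M, hM.2, fun a ha => ?_⟩, hM.1⟩
  by_contra haM
  have := hmax (insert a M) (hM.1.trans (Finset.subset_insert _ _)) ?_
  · rw [Finset.card_insert_of_notMem haM] at this
    omega
  · intro b hb d hd
    rw [Finset.mem_insert] at hb hd
    rcases hb with rfl | hb <;> rcases hd with rfl | hd
    · simp [Chord.crosses_iff]
    · exact ha d hd
    · rw [Chord.crosses_comm]; exact ha b hb
    · exact hM.2 b hb d hd

/-- The right side mentions neither `T` nor `c`, so all realisations have the same vertices. A
noncrossing set of `n - 3` chords is already maximal. Conversely, if a point realising `T'` lies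
inside a segment of the polytope, the coordinates of `T'` vanish at both ends, and they determine
the point. -/
theorem isVertex_iff {n : ℕ} [NeZero n] (T : Triangulation n) (c : PosConst n)
    (S : Finset (Chord n)) :
    IsVertex coord (associahedron T c) S ∧ S.card = n - 3 ↔
      ∃ T' : Triangulation n, T'.chords = S := by
  constructor
  · rintro ⟨⟨v, hv, hS⟩, hcard⟩
    obtain ⟨T', hT'⟩ := exists_triangulation_of_noncrossing S fun a ha b hb =>
      not_crosses_of_zero hv.1 ((hS a).1 ha) ((hS b).1 hb)
    exact ⟨T', (Finset.eq_of_subset_of_card_le hT' (by rw [hcard, card_chords])).symm⟩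
  · rintro ⟨T', rfl⟩
    obtain ⟨v, hv, h0⟩ := realizes T c T'
    refine ⟨⟨v, ⟨hv, ?_⟩, h0⟩, card_chords T'⟩
    rintro x hx y hy ⟨s, t, hs, ht, hst, rfl⟩
    have hz : ∀ a ∈ T'.chords, x a = 0 ∧ y a = 0 := fun a ha => by
      have e := (h0 a).1 ha
      simp only [Pi.add_apply, Pi.smul_apply, smul_eq_mul] at e
      have hx0 := hx.1 a
      have hy0 := hy.1 a
      have p1 := mul_nonneg hs.le hx0
      have p2 := mul_nonneg ht.le hy0
      exact ⟨(mul_eq_zero.1 (by linarith : s * x a = 0)).resolve_left hs.ne',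
        (mul_eq_zero.1 (by linarith : t * y a = 0)).resolve_left ht.ne'⟩
    refine sub_eq_zero.1 (eq_zero_of_zero_on (T' := T') (sub_mem_meshKernel hx hv) fun a ha => ?_)
    rw [Pi.sub_apply, (h0 a).1 ha, (hz a ha).1, sub_zero]

/-- At the vertex `T` all other coordinates are positive, so short steps along kernel vectors
positive on `T` stay in the polytope. Any kernel vector `u` is the difference of two of these, `K •
w + u` and `K • w`, where `w` is `1` on `T` and `K` is large. -/
theorem vectorSpan_associahedron {n : ℕ} [NeZero n] (T : Triangulation n) (c : PosConst n) :
    vectorSpan ℝ (associahedron T c) = meshKernel T := by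
  apply le_antisymm
  · refine Submodule.span_le.2 ?_
    rintro _ ⟨x, hx, y, hy, rfl⟩
    exact sub_mem_meshKernel hx hy
  · obtain ⟨v, hv, h0⟩ := realizes T c T
    obtain ⟨w, hw0, hw⟩ := exists_coords T T 1 0
    intro u hu
    have small : ∀ z : EmbeddingSpace n, (∀ a ∈ T.chords, 0 < z a) →
        ∀ᶠ ε : ℝ in nhdsWithin 0 (Ioi 0), ∀ a, 0 ≤ (v + ε • z) a := by
      intro z hz
      rw [Filter.eventually_all]
      intro a
      by_cases ha : a ∈ T.chords
      · filter_upwards [self_mem_nhdsWithin] with ε hε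
        have : 0 ≤ ε * z a := mul_nonneg (le_of_lt hε) (hz a ha).le
        simpa [(h0 a).1 ha] using this
      · have hpos : 0 < v a := lt_of_le_of_ne (hv.1 a) fun e => ha ((h0 a).2 e.symm)
        have cont : Filter.Tendsto (fun ε : ℝ => v a + ε * z a) (nhds 0) (nhds (v a + 0 * z a)) :=
          (continuous_const.add (continuous_id.mul continuous_const)).tendsto 0
        rw [zero_mul, add_zero] at cont
        filter_upwards [nhdsWithin_le_nhds (cont.eventually (lt_mem_nhds hpos))] with ε hε
        exact hε.le
    have mem : ∀ z ∈ meshKernel T, (∀ a ∈ T.chords, 0 < z a) →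
        ∀ᶠ ε : ℝ in nhdsWithin 0 (Ioi 0), v + ε • z ∈ associahedron T c := by
      intro z hz hz'
      filter_upwards [small z hz'] with ε hε
      exact ⟨hε, fun a ha => by rw [mandelstam_add_smul, hv.2 a ha, hz a ha]; simp⟩
    obtain ⟨K, hK⟩ : ∃ K : ℝ, ∀ a, |u a| < K := by
      obtain ⟨K, hK⟩ := (Set.finite_range fun a => |u a|).bddAbove
      exact ⟨K + 1, fun a => by have := hK ⟨a, rfl⟩; simp only at this; linarith⟩
    have hw' : w ∈ meshKernel T := hw
    have pos : ∀ a ∈ T.chords, 0 < K ∧ 0 < K + u a := fun a _ =>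
      ⟨(abs_nonneg _).trans_lt (hK a), by linarith [hK a, neg_abs_le (u a)]⟩
    obtain ⟨ε, ⟨h1, h2⟩, hε⟩ := (((mem (K • w) (Submodule.smul_mem _ _ hw') fun a ha => by
        simpa [hw0 a ha] using (pos a ha).1).and
      (mem (K • w + u) (Submodule.add_mem _ (Submodule.smul_mem _ _ hw') hu) fun a ha => by
        simpa [hw0 a ha] using (pos a ha).2)).and self_mem_nhdsWithin).exists
    have := Submodule.smul_mem _ ε⁻¹ (vsub_mem_vectorSpan ℝ h2 h1)
    have hε0 : ε ≠ 0 := ne_of_gt hε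
    rwa [vsub_eq_sub, smul_add, add_sub_add_left_eq_sub, add_sub_cancel_left, smul_smul,
      inv_mul_cancel₀ hε0, one_smul] at this


/-! ### Wedge products and orientation signs -/

section Forms

variable {V W ι : Type*} [AddCommGroup V] [Module ℝ V] [AddCommGroup W] [Module ℝ W] {k : ℕ}

theorem wedge_apply (α : Fin k → Module.Dual ℝ V) (v : Fin k → V) :
    wedge α v = (Matrix.of fun i j => α j (v i)).det := rfl

theorem wedge_compLinearMap (α : Fin k → Module.Dual ℝ V) (g : W →ₗ[ℝ] V) :
    (wedge α).compLinearMap g = wedge fun i => α i ∘ₗ g := rfl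

theorem wedge_comp_perm (α : Fin k → Module.Dual ℝ V) (π : Equiv.Perm (Fin k)) :
    wedge (fun i => α (π i)) = ((Equiv.Perm.sign π : ℤ) : ℝ) • wedge α := by
  ext v
  rw [AlternatingMap.smul_apply, smul_eq_mul, wedge_apply, wedge_apply,
    ← Matrix.det_permute' π (Matrix.of fun i j => α j (v i))]
  rfl

/-- A column operation. -/
theorem wedge_update_eq_neg (α : Fin k → Module.Dual ℝ V) (i : Fin k) {δ β γ : Module.Dual ℝ V}
    (hβ : β = 0 ∨ ∃ j ≠ i, β = α j) (hγ : γ = 0 ∨ ∃ j ≠ i, γ = α j) (h : α i + δ = β + γ) :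
    wedge (Function.update α i δ) = -wedge α := by
  have col : ∀ (η : Module.Dual ℝ V) (v : Fin k → V), wedge (Function.update α i η) v
      = ((Matrix.of fun i j => α j (v i)).updateCol i fun l => η (v l)).det := by
    intro η v
    rw [wedge_apply]
    congr 1
    ext l j
    by_cases hj : j = i
    · subst hj; simp
    · simp [hj]
  have side : ∀ η : Module.Dual ℝ V, (η = 0 ∨ ∃ j ≠ i, η = α j) → ∀ v,
      wedge (Function.update α i η) v = 0 := by
    intro η hη v
    rcases hη with rfl | ⟨j, hj, rfl⟩
    · rw [col]
      exact Matrix.det_eq_zero_of_column_eq_zero i fun l => by simp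
    · rw [wedge_apply]
      exact Matrix.det_zero_of_column_eq hj fun l => by simp [hj]
  have add : ∀ (η θ : Module.Dual ℝ V) (v : Fin k → V), wedge (Function.update α i (η + θ)) v =
      wedge (Function.update α i η) v + wedge (Function.update α i θ) v := by
    intro η θ v
    rw [col, col, col, ← Matrix.det_updateCol_add]
    rfl
  ext v
  have h1 := add (α i) δ v
  rw [h, add β γ v, side β hβ v, side γ hγ v, Function.update_eq_self] at h1
  rw [AlternatingMap.neg_apply]
  linarith

theorem alternatingMap_neg_smul (r : ℝ) (ω : V [⋀^Fin k]→ₗ[ℝ] ℝ) : -r • ω = -(r • ω) := by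
  ext v
  simp

theorem orientationSign_smul {ω : V [⋀^Fin k]→ₗ[ℝ] ℝ} (h : ω ≠ 0) {ε : ℝ}
    (hε : ε = 1 ∨ ε = -1) : orientationSign (rayOfNeZero ℝ ω h) (ε • ω) = ε := by
  unfold orientationSign
  rcases hε with rfl | rfl
  · simp [h]
  · have hs : (-1 : ℝ) • ω = -ω := by rw [alternatingMap_neg_smul, one_smul]
    have h1 : ¬ ∃ h' : (-1 : ℝ) • ω ≠ 0, rayOfNeZero ℝ _ h' = rayOfNeZero ℝ ω h := by
      rw [hs]
      rintro ⟨h', e⟩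
      rw [← neg_rayOfNeZero ℝ ω h] at e
      exact Module.Ray.ne_neg_self _ e.symm
    have h2 : ∃ h' : (-1 : ℝ) • ω ≠ 0, rayOfNeZero ℝ _ h' = -rayOfNeZero ℝ ω h := by
      rw [hs]
      exact ⟨neg_ne_zero.2 h, (neg_rayOfNeZero ℝ ω h).symm⟩
    rw [if_neg h1, if_pos h2]

theorem orientationSign_map (g : V ≃ₗ[ℝ] W) (o : Orientation ℝ V (Fin k))
    (ω : W [⋀^Fin k]→ₗ[ℝ] ℝ) : orientationSign (Orientation.map (Fin k) g o) ω =
      orientationSign o (ω.compLinearMap (g : V →ₗ[ℝ] W)) := by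
  have hz : ω.compLinearMap (g : V →ₗ[ℝ] W) ≠ 0 ↔ ω ≠ 0 := by
    refine not_congr ⟨fun h => ?_, fun h => by rw [h]; rfl⟩
    ext v
    have := congrArg (fun η : V [⋀^Fin k]→ₗ[ℝ] ℝ => η fun i => g.symm (v i)) h
    simpa using this
  have ray : ∀ (o' : Orientation ℝ V (Fin k)),
      (∃ h : ω ≠ 0, rayOfNeZero ℝ ω h = Orientation.map (Fin k) g o') ↔
      ∃ h : ω.compLinearMap (g : V →ₗ[ℝ] W) ≠ 0, rayOfNeZero ℝ _ h = o' := by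
    intro o'
    have key : ∀ (h : ω ≠ 0) (h' : ω.compLinearMap (g : V →ₗ[ℝ] W) ≠ 0),
        Orientation.map (Fin k) g (rayOfNeZero ℝ _ h') = rayOfNeZero ℝ ω h := by
      intro h h'
      rw [Orientation.map_apply]
      congr 1
      ext v
      simp
    constructor
    · rintro ⟨h, e⟩
      refine ⟨hz.2 h, (Orientation.map (Fin k) g).injective ?_⟩
      rw [key h, e]
    · rintro ⟨h, e⟩
      exact ⟨hz.1 h, by rw [← key (hz.1 h) h, e]⟩
  have ray' := ray (-o)
  rw [Orientation.map_neg] at ray'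
  classical
  exact if_congr (ray o) rfl (if_congr ray' rfl rfl)

theorem isVertex_image (f : V ≃ₗ[ℝ] W) (ℓ : ι → Module.Dual ℝ V) (P : Set V) (S : Finset ι) :
    IsVertex (fun a => ℓ a ∘ₗ f.symm.toLinearMap) (f '' P) S ↔ IsVertex ℓ P S := by
  unfold IsVertex
  have : (f '' P).extremePoints ℝ = f '' P.extremePoints ℝ :=
    (image_extremePoints f P).symm
  rw [this]
  simp

theorem alternatingMap_sum_apply {κ : Type*} (s : Finset κ) (ω : κ → V [⋀^Fin k]→ₗ[ℝ] ℝ)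
    (v : Fin k → V) : (∑ i ∈ s, ω i) v = ∑ i ∈ s, ω i v := by
  classical
  induction s using Finset.induction_on with
  | empty => simp
  | insert i s hi ih => rw [Finset.sum_insert hi, Finset.sum_insert hi, AlternatingMap.add_apply, ih]

/-- Canonical forms are natural with respect to linear isomorphisms. -/
theorem canonicalForm_image [Fintype ι] (f : V ≃ₗ[ℝ] W) (ℓ : ι → Module.Dual ℝ V) (P : Set V)
    (o : Orientation ℝ (vectorSpan ℝ P) (Fin k)) :
    canonicalForm (fun a => ℓ a ∘ₗ f.symm.toLinearMap) (f '' P) (mapOrientation f P o) =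
      Form.pullback f.symm.toLinearMap (canonicalForm ℓ P o) := by
  classical
  funext X
  ext v
  unfold Form.pullback canonicalForm
  rw [AlternatingMap.compLinearMap_apply, alternatingMap_sum_apply, alternatingMap_sum_apply]
  refine Finset.sum_congr rfl fun S _ => ?_
  by_cases h : IsVertex ℓ P S ∧ S.card = k
  · have h' : IsVertex (fun a => ℓ a ∘ₗ f.symm.toLinearMap) (f '' P) S ∧ S.card = k :=
      ⟨(isVertex_image f ℓ P S).2 h.1, h.2⟩
    rw [dif_pos h, dif_pos h']
    simp only [AlternatingMap.smul_apply]
    congr 1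
    refine (orientationSign_map _ o _).trans (congrArg _ ?_)
    rw [wedge_compLinearMap]
    congr 1
    funext i
    ext x
    exact congrArg _ (f.symm_apply_apply x.1)
  · have h' : ¬ (IsVertex (fun a => ℓ a ∘ₗ f.symm.toLinearMap) (f '' P) S ∧ S.card = k) :=
      fun h' => h ⟨(isVertex_image f ℓ P S).1 h'.1, h'.2⟩
    rw [dif_neg h, dif_neg h']
    rfl

end Forms

/-! ### Signs of the vertices -/

/-- `e` enumerates `S`. -/
def IsEnum {n k : ℕ} (S : Finset (Chord n)) (e : Fin k → Chord n) : Prop :=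
  Function.Injective e ∧ ∀ d, d ∈ S ↔ ∃ i, e i = d

theorem isEnum_equiv {n k : ℕ} {S : Finset (Chord n)} (e : Fin k ≃ S) :
    IsEnum S fun i => (e i : Chord n) :=
  ⟨fun _ _ h => e.injective (Subtype.ext h),
    fun d => ⟨fun hd => ⟨e.symm ⟨d, hd⟩, by simp⟩, by rintro ⟨i, rfl⟩; exact (e i).2⟩⟩

/-- The form `⋀ dx_{e i}`, restricted to a subspace. -/
noncomputable def chordWedge {n k : ℕ} (U : Submodule ℝ (EmbeddingSpace n)) (e : Fin k → Chord n) :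
    U [⋀^Fin k]→ₗ[ℝ] ℝ :=
  wedge fun i => (coord (e i)).domRestrict U

/-- Evaluated on the basis dual to the chords of `T'`, the determinant is that of the identity
matrix. -/
theorem chordWedge_ne_zero {n k : ℕ} [NeZero n] {T T' : Triangulation n} {e : Fin k → Chord n}
    (he : IsEnum T'.chords e) : chordWedge (meshKernel T) e ≠ 0 := by
  classical
  choose v hv hv' using fun i => exists_coords T T' (fun d => if d = e i then 1 else 0) 0
  intro h
  have h1 := congrArg (fun η : (meshKernel T) [⋀^Fin k]→ₗ[ℝ] ℝ => η fun i => ⟨v i, hv' i⟩) h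
  unfold chordWedge at h1
  simp only [wedge_apply] at h1
  have : (Matrix.of fun i j : Fin k =>
      (coord (e j)).domRestrict (meshKernel T) ⟨v i, hv' i⟩) = 1 := by
    ext i j
    have := hv i (e j) ((he.2 _).2 ⟨j, rfl⟩)
    change v i (e j) = _
    refine this.trans ?_
    simp only [he.1.eq_iff, Matrix.one_apply, eq_comm]
  rw [this, Matrix.det_one] at h1
  exact one_ne_zero h1

theorem chordWedge_perm {n k : ℕ} {S : Finset (Chord n)} {e e' : Fin k → Chord n}
    (he : IsEnum S e) (he' : IsEnum S e') : ∃ ε : ℝ, (ε = 1 ∨ ε = -1) ∧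
      ∀ U : Submodule ℝ (EmbeddingSpace n), chordWedge U e' = ε • chordWedge U e := by
  choose π hπ using fun i => (he.2 (e' i)).1 ((he'.2 _).2 ⟨i, rfl⟩)
  have hinj : Function.Injective π := fun i j h => he'.1 (by rw [← hπ, ← hπ, h])
  let ρ : Equiv.Perm (Fin k) := Equiv.ofBijective π (Finite.injective_iff_bijective.1 hinj)
  refine ⟨((Equiv.Perm.sign ρ : ℤ) : ℝ), ?_, fun U => ?_⟩
  · rcases Int.units_eq_one_or (Equiv.Perm.sign ρ) with h | h <;> simp [h]
  · unfold chordWedge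
    rw [← wedge_comp_perm]
    congr 1
    funext i
    rw [← hπ i]
    rfl

/-- On the kernel `dx_a + dx_b` is a sum of side differentials; each is zero or already a factor of
the wedge, so only `-dx_a` survives. -/
theorem IsFlip.chordWedge_update {n k : ℕ} [NeZero n] {T T₁ T₂ : Triangulation n} {a b : Chord n}
    (h : IsFlip T₁ T₂ a b) {e : Fin k → Chord n} (he : IsEnum T₁.chords e) {i : Fin k}
    (hi : e i = a) :
    chordWedge (meshKernel T) (Function.update e i b) = -chordWedge (meshKernel T) e := by
  obtain ⟨β, γ, hβ, hγ, h'⟩ := h.exchange T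
  have side : ∀ η, IsSide (T₁.chords.erase a) η → η.domRestrict (meshKernel T) = 0 ∨
      ∃ j ≠ i, η.domRestrict (meshKernel T) = (coord (e j)).domRestrict (meshKernel T) := by
    rintro η (rfl | ⟨d, hd, rfl⟩)
    · exact Or.inl rfl
    · obtain ⟨hda, hd⟩ := Finset.mem_erase.1 hd
      obtain ⟨j, rfl⟩ := (he.2 d).1 hd
      exact Or.inr ⟨j, fun hj => hda (by rw [hj, hi]), rfl⟩
  have := wedge_update_eq_neg (fun j => (coord (e j)).domRestrict (meshKernel T)) i
    (δ := (coord b).domRestrict (meshKernel T)) (side β hβ) (side γ hγ)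
    (by ext ⟨w, hw⟩; rw [hi]; exact h' w hw)
  unfold chordWedge
  rw [← this]
  congr 1
  funext j
  by_cases hj : j = i
  · subst hj; simp
  · simp [hj]

theorem IsFlip.isEnum_update {n k : ℕ} [NeZero n] {T₁ T₂ : Triangulation n} {a b : Chord n}
    (h : IsFlip T₁ T₂ a b) {e : Fin k → Chord n} (he : IsEnum T₁.chords e) {i : Fin k}
    (hi : e i = a) : IsEnum T₂.chords (Function.update e i b) := by
  have hb : ∀ j, e j ≠ b := fun j hj => h.notMem ((he.2 b).2 ⟨j, hj⟩)
  constructor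
  · intro j l hjl
    by_cases hj : j = i <;> by_cases hl : l = i
    · rw [hj, hl]
    · subst hj; simp only [Function.update_self, ne_eq, hl, not_false_eq_true,
        Function.update_of_ne] at hjl
      exact (hb l hjl.symm).elim
    · subst hl; simp only [Function.update_self, ne_eq, hj, not_false_eq_true,
        Function.update_of_ne] at hjl
      exact (hb j hjl).elim
    · simp only [ne_eq, hj, hl, not_false_eq_true, Function.update_of_ne] at hjl
      exact he.1 hjl
  · intro d
    rw [h.chords_eq, Finset.mem_insert, Finset.mem_erase]
    constructor
    · rintro (rfl | ⟨hda, hd⟩)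
      · exact ⟨i, Function.update_self ..⟩
      · obtain ⟨j, rfl⟩ := (he.2 d).1 hd
        exact ⟨j, Function.update_of_ne (fun hj => hda (by rw [hj, hi])) ..⟩
    · rintro ⟨j, rfl⟩
      by_cases hj : j = i
      · subst hj; left; simp
      · right
        rw [Function.update_of_ne hj, ← hi]
        exact ⟨fun e' => hj (he.1 e'), (he.2 _).2 ⟨j, rfl⟩⟩

/-- The relative sign of two vertices does not depend on the realisation. -/
theorem exists_sign {n k : ℕ} [NeZero n] {e₀ : Fin k → Chord n} (he₀ : IsEnum (fan n).chords e₀)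
    {T' : Triangulation n} {e : Fin k → Chord n} (he : IsEnum T'.chords e) :
    ∃ ε : ℝ, (ε = 1 ∨ ε = -1) ∧ ∀ T : Triangulation n,
      chordWedge (meshKernel T) e = ε • chordWedge (meshKernel T) e₀ := by
  revert e
  refine flip_induction (p := fun T' => ∀ {e : Fin k → Chord n}, IsEnum T'.chords e →
    ∃ ε : ℝ, (ε = 1 ∨ ε = -1) ∧ ∀ T : Triangulation n,
      chordWedge (meshKernel T) e = ε • chordWedge (meshKernel T) e₀) ?_ ?_ T'
  · intro e he
    obtain ⟨ε, hε, h⟩ := chordWedge_perm he₀ he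
    exact ⟨ε, hε, fun T => h _⟩
  · intro T₁ T₂ a b h ih e he
    obtain ⟨i, hi⟩ := (he.2 b).1 h.symm.mem
    -- Putting `a` in the slot of `b` enumerates `T₁`, at the cost of one sign.
    obtain ⟨ε, hε, h'⟩ := ih (h.symm.isEnum_update he hi)
    refine ⟨-ε, by rcases hε with rfl | rfl <;> simp, fun T => ?_⟩
    rw [alternatingMap_neg_smul, ← h' T, h.symm.chordWedge_update he hi, neg_neg]

/-- Each polytope is oriented so that one fixed enumeration of the fan is positive. The sign at any
other vertex is then its sign relative to the fan, which `exists_sign` supplies before `T` is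
chosen. -/
theorem exists_orientation {n : ℕ} [NeZero n] :
    ∃ o : ∀ (T : Triangulation n) (c : PosConst n),
        Orientation ℝ (vectorSpan ℝ (associahedron T c)) (Fin (n - 3)),
      ∀ (e : Fin (n - 3) → Chord n) (T' : Triangulation n), IsEnum T'.chords e →
        ∃ ε : ℝ, ∀ T c,
          orientationSign (o T c) (chordWedge (vectorSpan ℝ (associahedron T c)) e) = ε := by
  set e₀ : Fin (n - 3) ≃ (fan n).chords := ((fan n).chords.equivFinOfCardEq card_fan).symm
  have he₀ := isEnum_equiv e₀
  have hne : ∀ T (c : PosConst n),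
      chordWedge (vectorSpan ℝ (associahedron T c)) (fun i => (e₀ i : Chord n)) ≠ 0 := by
    intro T c
    rw [vectorSpan_associahedron]
    exact chordWedge_ne_zero he₀
  refine ⟨fun T c => rayOfNeZero ℝ _ (hne T c), fun e T' he => ?_⟩
  obtain ⟨ε, hε, h⟩ := exists_sign he₀ he
  refine ⟨ε, fun T c => ?_⟩
  have : chordWedge (vectorSpan ℝ (associahedron T c)) e
      = ε • chordWedge (vectorSpan ℝ (associahedron T c)) (fun i => (e₀ i : Chord n)) := by
    rw [vectorSpan_associahedron]
    exact h T
  rw [this]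
  exact orientationSign_smul (hne T c) hε

end ABHY

/-! ### Comparison of the canonical forms -/

theorem mainTheorem3 (n : ℕ) [NeZero n] (hn : 3 ≤ n) :
    ∃ o : ∀ (T : ABHY.Triangulation n) (c : ABHY.PosConst n),
        Orientation ℝ (vectorSpan ℝ (ABHY.associahedron T c)) (Fin (n - 3)),
      (∀ (T₁ T₂ : ABHY.Triangulation n) (c₁ c₂ : ABHY.PosConst n),
        Set.EqOn (ABHY.Omega T₁ c₁ (o T₁ c₁)) (ABHY.Omega T₂ c₂ (o T₂ c₂)) (ABHY.regular n)) ∧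
      ∀ σ : Equiv.Perm (Fin n),
        (∀ (T : ABHY.Triangulation n) (c : ABHY.PosConst n),
          Set.EqOn
            (ABHY.OmegaDeformed T c σ
              (ABHY.mapOrientation (ABHY.fMap σ) (ABHY.associahedron T c) (o T c)))
            (ABHY.Form.pullback (ABHY.fMap σ).symm.toLinearMap (ABHY.Omega T c (o T c)))
            (ABHY.regularDeformed σ)) ∧
        ∀ (T₁ T₂ : ABHY.Triangulation n) (c₁ c₂ : ABHY.PosConst n),
          Set.EqOn
            (ABHY.OmegaDeformed T₁ c₁ σ
              (ABHY.mapOrientation (ABHY.fMap σ) (ABHY.associahedron T₁ c₁) (o T₁ c₁)))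
            (ABHY.OmegaDeformed T₂ c₂ σ
              (ABHY.mapOrientation (ABHY.fMap σ) (ABHY.associahedron T₂ c₂) (o T₂ c₂)))
            (ABHY.regularDeformed σ) := by
  obtain ⟨o, ho⟩ := ABHY.exists_orientation (n := n)
  have ha : ∀ (T₁ T₂ : ABHY.Triangulation n) (c₁ c₂ : ABHY.PosConst n),
      ABHY.Omega T₁ c₁ (o T₁ c₁) = ABHY.Omega T₂ c₂ (o T₂ c₂) := by
    intro T₁ T₂ c₁ c₂
    funext x
    unfold ABHY.Omega ABHY.canonicalForm
    -- The `d log` factors depend only on `S`, so it remains to match which `S` contribute and with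
    -- what sign.
    refine Finset.sum_congr rfl fun S _ => ?_
    by_cases h : ∃ T' : ABHY.Triangulation n, T'.chords = S
    · have h₁ := (ABHY.isVertex_iff T₁ c₁ S).2 h
      have h₂ := (ABHY.isVertex_iff T₂ c₂ S).2 h
      rw [dif_pos h₁, dif_pos h₂]
      obtain ⟨T', rfl⟩ := h
      obtain ⟨ε, hε⟩ := ho _ T' (ABHY.isEnum_equiv (T'.chords.equivFinOfCardEq h₁.2).symm)
      exact congrArg (· • _) ((hε T₁ c₁).trans (hε T₂ c₂).symm)
    · rw [dif_neg fun h' => h ((ABHY.isVertex_iff T₁ c₁ S).1 h'),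
        dif_neg fun h' => h ((ABHY.isVertex_iff T₂ c₂ S).1 h')]
  have hb : ∀ (σ : Equiv.Perm (Fin n)) (T : ABHY.Triangulation n) (c : ABHY.PosConst n),
      ABHY.OmegaDeformed T c σ
        (ABHY.mapOrientation (ABHY.fMap σ) (ABHY.associahedron T c) (o T c)) =
      ABHY.Form.pullback (ABHY.fMap σ).symm.toLinearMap (ABHY.Omega T c (o T c)) :=
    fun σ T c => ABHY.canonicalForm_image (ABHY.fMap σ) ABHY.coord (ABHY.associahedron T c) (o T c)
  refine ⟨o, fun T₁ T₂ c₁ c₂ x _ => by rw [ha T₁ T₂ c₁ c₂], fun σ => ⟨fun T c x _ => by rw [hb],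
    fun T₁ T₂ c₁ c₂ x _ => by rw [hb, hb, ha T₁ T₂ c₁ c₂]⟩⟩
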